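/- Let $\nu=(p_i)_{i\ge 0}$ be a probability distribution on $\{0,1,2,\dots\}$ with mean $\sum_i i\,p_i=1$ and variance $\sigma^2=\sum_i (i-1)^2p_i$ satisfying $0<\sigma^2<\infty$. Let $T$ be a Galton–Watson tree with offspring distribution $\nu$, that is, the random rooted ordered tree in which the numbers of children of the nodes are independent with distribution $\nu$, and let $|T|$ be its number of nodes. The Horton–Strahler number $\mathrm{HS}(t)$ of a finite rooted tree $t$ is defined recursively: it is $0$ if $t$ is a single node; otherwise it is the maximum of the Horton–Strahler numbers of the subtrees rooted at the children of the root, plus one if this maximum is attained by at least two of these children. Then, for every $\varepsilon>0$, $$\mathbb P\bigl\{\mathrm{HS}(T)\ge (\tfrac12+\varepsilon)\log_2 n \,\bigm|\, |T|=n\bigr\}\longrightarrow 0$$ as $n\to\infty$ along the integers $n$ with $\mathbb P\{|T|=n\}>0$. -/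

import Mathlib

open MeasureTheory ProbabilityTheory Filter Topology

/-- Finite rooted ordered trees: a root together with the list of the subtrees rooted at its
children. A leaf is `node []`. -/
inductive PlaneTree : Type
  | node : List PlaneTree → PlaneTree

namespace PlaneTree

/-- The number of nodes of the tree. -/
def size : PlaneTree → ℕ
  | node ts => 1 + (ts.map size).sum

/-- The Horton-Strahler number. With `l` the list of the Horton-Strahler numbers of the subtrees
at the children of the root and `m` the maximum of `l`, it is `m`, plus one if at least two
entries of `l` are equal to `m`. For a leaf, `l` is empty and the value is `0`. -/
def hortonStrahler : PlaneTree → ℕ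
  | node ts =>
    let l := ts.map hortonStrahler
    let m := l.foldr max 0
    m + if 1 < l.count m then 1 else 0

theorem hortonStrahler_leaf : (node []).hortonStrahler = 0 := by
  simp [hortonStrahler]

end PlaneTree

/-- Nodes are addressed by words: `[]` is the root, and `i :: u` is the node with address `u` in
the subtree at the `i`-th child of the root (counted from `0`). If `d u` is the number of children
of the node `u`, then `IsFamilyTree d t` says that the tree grown from the root with these numbers
of children is the finite tree `t`. -/
inductive IsFamilyTree : (List ℕ → ℕ) → PlaneTree → Prop
  | node (d : List ℕ → ℕ) (ts : List PlaneTree) (hroot : d [] = ts.length)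
      (hsub : ∀ i : Fin ts.length, IsFamilyTree (fun u => d ((i : ℕ) :: u)) (ts.get i)) :
      IsFamilyTree d (PlaneTree.node ts)

theorem IsFamilyTree.unique {d : List ℕ → ℕ} {s t : PlaneTree}
    (hs : IsFamilyTree d s) (ht : IsFamilyTree d t) : s = t := by
  induction hs generalizing t with
  | node d ss hroot hsub ih =>
    cases ht with
    | node _ ts hroot' hsub' =>
      have hlen : ss.length = ts.length := hroot.symm.trans hroot'
      congr 1
      refine List.ext_get hlen fun i h₁ h₂ => ?_
      exact ih ⟨i, h₁⟩ (hsub' ⟨i, h₂⟩)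

open Classical in
/-- The tree grown from the root with the numbers of children `d`: the value is `some t` if this
tree is the finite tree `t`, and `none` if it is infinite. -/
noncomputable def familyTree (d : List ℕ → ℕ) : Option PlaneTree :=
  if h : ∃ t, IsFamilyTree d t then some h.choose else none

theorem familyTree_eq_some_iff {d : List ℕ → ℕ} {t : PlaneTree} :
    familyTree d = some t ↔ IsFamilyTree d t := by
  unfold familyTree
  split_ifs with h
  · rw [Option.some.injEq]
    exact ⟨fun e => e ▸ h.choose_spec, fun ht => h.choose_spec.unique ht⟩
  · exact ⟨fun e => by simp at e, fun ht => (h ⟨t, ht⟩).elim⟩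

/-- `ξ` is a family of independent random variables on `(Ω, P)`, indexed by the potential nodes,
each with the offspring distribution `ν`. -/
structure IsOffspringFamily {Ω : Type*} [MeasurableSpace Ω] (P : Measure Ω) (ν : Measure ℕ)
    (ξ : List ℕ → Ω → ℕ) : Prop where
  measurable : ∀ u, Measurable (ξ u)
  map_eq : ∀ u, P.map (ξ u) = ν
  indep : iIndepFun ξ P

/-- The Galton-Watson tree in which the node `u`, if present, has `ξ u` children; the value `none`
stands for an infinite tree. -/
noncomputable def galtonWatsonTree {Ω : Type*} (ξ : List ℕ → Ω → ℕ) (ω : Ω) : Option PlaneTree :=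
  familyTree fun u => ξ u ω

/-- The event that the Galton-Watson tree has exactly `n` nodes. -/
def sizeEvent {Ω : Type*} (ξ : List ℕ → Ω → ℕ) (n : ℕ) : Set Ω :=
  {ω | ∃ t, galtonWatsonTree ξ ω = some t ∧ t.size = n}

/-- The event that the Galton-Watson tree is finite, with Horton-Strahler number at least `x`. -/
def hortonStrahlerEvent {Ω : Type*} (ξ : List ℕ → Ω → ℕ) (x : ℝ) : Set Ω :=
  {ω | ∃ t, galtonWatsonTree ξ ω = some t ∧ x ≤ (t.hortonStrahler : ℝ)}

/-! ### Preorder codes of trees and forests as lattice paths -/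

namespace PlaneTree

/-! Mark a uniform node of a tree of size `n`. If the Horton–Strahler number is at least `k + 1`,
some subtree hanging off the path from the marked node to the root, or the subtree at the node
itself, has number at least `k` (`hortonStrahler_tree_le`); by mirror symmetry it may be taken in
the right forest. At least half of the nodes have `n / 4` nodes before them in preorder and in
mirrored preorder.

Reading the preorder code cyclically from the marked node is a weight-preserving bijection between
marked trees of size `n` and words of length `n` and sum `n - 1` (cycle lemma). The code of the
right forest then lies within the first `n - n / 4` letters, so the last `n / 4` letters matter only
through their sum. The local limit estimates make the cost of this sum condition of order `n ^
(-1/2)`, as is the probability that `n` letters have sum `n - 1`. These factors cancel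
(`exists_iSup_sumProb_le`), and up to a constant the conditional probability is bounded by the
probability that a high tree is completed within at most `n` unconditioned letters.

By a Chernoff bound, such a word completes fewer than `R ≈ n ^ (1/2 + ε/2)` trees except with
negligible probability (`laplace_le`). Each tree is high with probability at most a constant times
`θ ^ k`, for any fixed `θ > 1/2` (`highWeight_le`): with `f` the offspring generating function, the
probabilities of a number below `k` are Newton iterates for `f(s) = s`, which has a double root at
`1` since the mean is `1`, and Newton's method halves the distance to a double root asymptotically.
With `k ≈ (1/2 + ε) log₂ n` and `θ` close to `1/2`, the union bound `R * θ ^ k` tends to `0`. -/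

theorem nodeInduction {motive : PlaneTree → Prop}
    (h : ∀ ts, (∀ t ∈ ts, motive t) → motive (node ts)) : ∀ t, motive t
  | node ts => h ts fun t _ => nodeInduction h t

/-- The word of the numbers of children of the nodes, in preorder. -/
def code : PlaneTree → List ℕ
  | node ts => ts.length :: (ts.map code).flatten

/-- The concatenation of the codes of the trees of an ordered forest. -/
def forestCode (ts : List PlaneTree) : List ℕ := (ts.map code).flatten

theorem code_node (ts : List PlaneTree) : (node ts).code = ts.length :: forestCode ts := by
  rw [code, forestCode]

theorem size_node (ts : List PlaneTree) : (node ts).size = 1 + (ts.map size).sum := by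
  rw [size]

@[simp] theorem forestCode_nil : forestCode [] = [] := rfl

@[simp] theorem forestCode_cons (t : PlaneTree) (ts : List PlaneTree) :
    forestCode (t :: ts) = t.code ++ forestCode ts := by
  simp [forestCode]

@[simp] theorem forestCode_append (ts ss : List PlaneTree) :
    forestCode (ts ++ ss) = forestCode ts ++ forestCode ss := by
  simp [forestCode]

theorem length_code (t : PlaneTree) : t.code.length = t.size := by
  induction t using nodeInduction with
  | h ts ih =>
    rw [code_node, size_node, forestCode]
    simp only [List.length_cons, List.length_flatten, List.map_map]
    rw [add_comm, List.map_congr_left (f := List.length ∘ code) (g := size) fun t ht => ih t ht]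

theorem size_pos (t : PlaneTree) : 0 < t.size := by
  cases t; rw [size_node]; omega

theorem code_ne_nil (t : PlaneTree) : t.code ≠ [] := by
  cases t; simp [code_node]

/-- The final height of the lattice path with steps `d - 1`, for `d` in the word. -/
def height (w : List ℕ) : ℤ := (w.sum : ℤ) - w.length

@[simp] theorem height_nil : height [] = 0 := rfl

@[simp] theorem height_cons (d : ℕ) (w : List ℕ) : height (d :: w) = (d : ℤ) - 1 + height w := by
  simp [height]; ring

@[simp] theorem height_append (u v : List ℕ) : height (u ++ v) = height u + height v := by
  simp [height]; ring

theorem height_forestCode_of (ts : List PlaneTree) (h : ∀ t ∈ ts, height t.code = -1) :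
    height (forestCode ts) = -ts.length := by
  induction ts with
  | nil => rfl
  | cons t ts ih =>
    rw [forestCode_cons, height_append, h t (by simp), ih fun s hs => h s (by simp [hs])]
    simp

@[simp] theorem height_code (t : PlaneTree) : height t.code = -1 := by
  induction t using nodeInduction with
  | h ts ih => rw [code_node, height_cons, height_forestCode_of ts ih]; ring

@[simp] theorem height_forestCode (ts : List PlaneTree) : height (forestCode ts) = -ts.length :=
  height_forestCode_of ts fun t _ => height_code t

/-- The path descends by exactly one over each tree and stays nonnegative strictly inside a tree, so
the level minus the number of trees is first reached at the very end. -/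
theorem lt_height_of_forestCode_of (ts : List PlaneTree)
    (h : ∀ t ∈ ts, ∀ u v, t.code = u ++ v → v ≠ [] → 0 ≤ height u) {u v : List ℕ}
    (huv : forestCode ts = u ++ v) (hv : v ≠ []) : -(ts.length : ℤ) < height u := by
  induction ts generalizing u with
  | nil => simp_all
  | cons t ts ih =>
    rw [forestCode_cons, List.append_eq_append_iff] at huv
    rcases huv with ⟨c, rfl, hc⟩ | ⟨c, hc, rfl⟩
    · have := ih (fun s hs => h s (by simp [hs])) hc
      simp; omega
    · rcases eq_or_ne c [] with rfl | hne
      · have hu : height u = -1 := by simpa [height_code] using (congrArg height hc).symm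
        have : ts ≠ [] := by rintro rfl; simp at hv
        have := List.length_pos_iff.2 this
        simp; omega
      · have := h t (by simp) u c hc hne
        simp; omega

theorem height_nonneg_of_code {t : PlaneTree} {u v : List ℕ} (huv : t.code = u ++ v)
    (hv : v ≠ []) : 0 ≤ height u := by
  induction t using nodeInduction generalizing u v with
  | h ts ih =>
    rw [code_node] at huv
    rcases u with _ | ⟨d, u⟩
    · simp
    · simp only [List.cons_append, List.cons.injEq] at huv
      have := lt_height_of_forestCode_of ts (fun t ht u v h h' => ih t ht h h') huv.2 hv
      rw [height_cons, ← huv.1]; omega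

/-- Parse by removing the first letter `d`: the rest codes a forest with `d - 1` more trees, and its
first `d` trees become the children of the first root. -/
theorem exists_forestCode_eq (w : List ℕ) (r : ℕ) (hw : height w = -r)
    (h : ∀ u v, w = u ++ v → v ≠ [] → -(r : ℤ) < height u) :
    ∃ ts : List PlaneTree, ts.length = r ∧ forestCode ts = w := by
  induction w generalizing r with
  | nil =>
    have : r = 0 := by simpa using hw
    exact ⟨[], by simp [this]⟩
  | cons d w ih =>
    have hr : 0 < r := by simpa using h [] (d :: w) rfl (by simp)
    obtain ⟨s, rfl⟩ : ∃ s, r = s + 1 := ⟨r - 1, by omega⟩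
    obtain ⟨ts, hlen, hts⟩ := ih (s + d) (by simp at hw ⊢; omega) (by
      intro u v huv hv
      have := h (d :: u) v (by simp [huv]) hv
      simp at this ⊢; omega)
    refine ⟨node (ts.take d) :: ts.drop d, by simp; omega, ?_⟩
    rw [forestCode_cons, code_node, List.cons_append, ← forestCode_append, List.take_append_drop,
      hts, List.length_take, min_eq_left (by omega)]

theorem forestCode_append_inj_of (ts ss : List PlaneTree) (hlen : ts.length = ss.length)
    (h : ∀ t ∈ ts, ∀ s x y, t.code ++ x = s.code ++ y → t = s ∧ x = y) {x y : List ℕ}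
    (hxy : forestCode ts ++ x = forestCode ss ++ y) : ts = ss ∧ x = y := by
  induction ts generalizing ss with
  | nil =>
    have : ss = [] := by simpa [eq_comm] using hlen
    subst this
    simpa using hxy
  | cons t ts ih =>
    rcases ss with _ | ⟨s, ss⟩
    · simp at hlen
    · simp only [forestCode_cons, List.append_assoc] at hxy
      obtain ⟨rfl, h2⟩ := h t (by simp) s _ _ hxy
      obtain ⟨rfl, h3⟩ := ih ss (by simpa using hlen) (fun s hs => h s (by simp [hs])) h2
      exact ⟨rfl, h3⟩

/-- Codes form a prefix code: the root letter announces how many child codes follow, so decoding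
never has a choice. -/
theorem code_append_inj {t s : PlaneTree} {x y : List ℕ} (h : t.code ++ x = s.code ++ y) :
    t = s ∧ x = y := by
  induction t using nodeInduction generalizing s x y with
  | h ts ih =>
    obtain ⟨ss⟩ := s
    simp only [code_node, List.cons_append, List.cons.injEq] at h
    obtain ⟨rfl, h2⟩ := forestCode_append_inj_of ts ss h.1 (fun t ht s x y h => ih t ht h) h.2
    exact ⟨rfl, h2⟩

theorem code_injective : Function.Injective code := fun t s h =>
  (code_append_inj (x := []) (y := []) (by simpa using h)).1

/-! ### Cyclic rotations of codes -/

/-- Two rotations of codes of trees agree only if they are rotations of the same code by the same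
amount. -/
theorem rotation_unique {t s : PlaneTree} {u v u' v' : List ℕ} (ht : t.code = u ++ v)
    (hs : s.code = u' ++ v') (hv : v ≠ []) (hv' : v' ≠ []) (h : v ++ u = v' ++ u') :
    t = s ∧ u = u' := by
  wlog hle : ∃ x, v' = v ++ x generalizing t s u v u' v'
  · have hx : ∃ x, v = v' ++ x := by
      rw [List.append_eq_append_iff] at h
      rcases h with ⟨x, hx, -⟩ | ⟨x, hx, -⟩
      · exact absurd ⟨x, hx⟩ hle
      · exact ⟨x, hx⟩
    obtain ⟨h1, h2⟩ := this hs ht hv' hv h.symm hx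
    exact ⟨h1.symm, h2.symm⟩
  obtain ⟨x, rfl⟩ := hle
  have hu : u = x ++ u' := by simpa using h
  subst hu
  rcases eq_or_ne x [] with rfl | hx
  · exact ⟨code_injective (by rw [ht, hs]; simp), by simp⟩
  -- Here `t.code = x ++ u' ++ v` and `s.code = u' ++ v ++ x`. Both `x` and `u' ++ v` are proper
  -- prefixes of codes, hence of nonnegative height, yet their heights add up to `-1`.
  · have h1 : 0 ≤ height x := height_nonneg_of_code (v := u' ++ v) (by rw [ht]; simp) (by simp [hv])
    have h2 : 0 ≤ height (u' ++ v) :=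
      height_nonneg_of_code (v := x) (by rw [hs]; simp) hx
    have h3 := height_code t
    rw [ht] at h3
    simp at h2 h3
    omega

theorem exists_first_argmin (H : ℕ → ℤ) (n : ℕ) :
    ∃ k ≤ n, (∀ j ≤ n, H k ≤ H j) ∧ ∀ j < k, H k < H j := by
  have hex : ∃ k, k ≤ n ∧ ∀ j ≤ n, H k ≤ H j := by
    obtain ⟨k, hk, hmin⟩ := Finset.exists_min_image (Finset.range (n + 1)) H ⟨0, by simp⟩
    exact ⟨k, by simpa [Nat.lt_succ_iff] using hk,
      fun j hj => hmin j (by simpa [Nat.lt_succ_iff] using hj)⟩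
  classical
  obtain ⟨h1, h2⟩ := Nat.find_spec hex
  refine ⟨Nat.find hex, h1, h2, fun j hj => ?_⟩
  by_contra! hcon
  exact Nat.find_min hex hj ⟨by omega, fun i hi => hcon.trans (h2 i hi)⟩

/-- Every word of total height `-1` is a rotation of the code of a tree. -/
theorem exists_rotation (w : List ℕ) (hw : height w = -1) :
    ∃ (t : PlaneTree) (u v : List ℕ), t.code = u ++ v ∧ v ≠ [] ∧ w = v ++ u := by
  -- Cut where the path first reaches its minimum. After the wrap-around the path has lost `1` in
  -- total, and the strict inequality before the first minimum makes up for this loss.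
  obtain ⟨k, hkn, hmin, hlt⟩ := exists_first_argmin (fun j => height (w.take j)) w.length
  have hab : height (w.take k) + height (w.drop k) = -1 := by
    rw [← height_append, List.take_append_drop, hw]
  obtain ⟨ts, hlen, hts⟩ := exists_forestCode_eq (w.drop k ++ w.take k) 1
    (by rw [height_append]; push_cast; omega) (by
      intro u v huv hv
      push_cast
      suffices 0 ≤ height u by omega
      rw [List.append_eq_append_iff] at huv
      rcases huv with ⟨c, rfl, hc⟩ | ⟨c, hc, rfl⟩
      · have hck : c.length < k := by
          have h1 := congrArg List.length hc
          have h2 := List.length_pos_iff.2 hv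
          simp at h1; omega
        have hct : c = w.take c.length := by
          have : (w.take k).take c.length = c := by rw [hc]; simp
          rw [List.take_take, min_eq_left hck.le] at this
          exact this.symm
        have := hlt c.length hck
        rw [← hct] at this
        rw [height_append]
        omega
      · have hlenu : k + u.length ≤ w.length := by
          have h1 := congrArg List.length hc
          simp at h1; omega
        have hku : w.take (k + u.length) = w.take k ++ u := by
          rw [List.take_add, hc]; simp
        have := hmin _ hlenu
        simp only [hku, height_append] at this
        omega)
  obtain ⟨t, rfl⟩ := List.length_eq_one_iff.1 hlen
  rw [forestCode_cons, forestCode_nil, List.append_nil] at hts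
  -- If the minimum is at time `0` there is no rotation; the nonempty part `v` must then be the
  -- whole word.
  rcases eq_or_ne (w.take k) [] with h0 | h0
  · have hd : w.drop k = w := by
      have := List.take_append_drop k w
      rwa [h0, List.nil_append] at this
    refine ⟨t, [], w, by rw [hts, h0, hd]; simp, ?_, by simp⟩
    rintro rfl
    simp at hw
  · exact ⟨t, w.drop k, w.take k, hts, h0, by simp⟩

/-! ### Mirror images -/

/-- The mirror image of a tree. -/
def mirror : PlaneTree → PlaneTree
  | node ts => node (ts.map mirror).reverse

theorem mirror_node (ts : List PlaneTree) : (node ts).mirror = node (ts.map mirror).reverse := by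
  rw [mirror]

@[simp] theorem mirror_mirror (t : PlaneTree) : t.mirror.mirror = t := by
  induction t using nodeInduction with
  | h ts ih =>
    rw [mirror_node, mirror_node, List.map_reverse, List.reverse_reverse, List.map_map,
      List.map_congr_left (g := id) (by simpa using ih), List.map_id]

theorem perm_code_mirror (t : PlaneTree) : t.mirror.code.Perm t.code := by
  induction t using nodeInduction with
  | h ts ih =>
    rw [mirror_node, code_node, code_node, List.length_reverse, List.length_map, forestCode,
      forestCode]
    refine List.Perm.cons _ ?_
    refine (((List.reverse_perm _).map code).flatten).trans ?_
    induction ts with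
    | nil => simp
    | cons t ts ih' =>
      simp only [List.map_cons, List.flatten_cons]
      exact (ih t (by simp)).append (ih' fun s hs => ih s (by simp [hs]))

@[simp] theorem size_mirror (t : PlaneTree) : t.mirror.size = t.size := by
  rw [← length_code, ← length_code, (perm_code_mirror t).length_eq]

theorem hortonStrahler_node (ts : List PlaneTree) :
    (node ts).hortonStrahler = (ts.map hortonStrahler).foldr max 0 +
      if 1 < (ts.map hortonStrahler).count ((ts.map hortonStrahler).foldr max 0) then 1 else 0 := by
  rw [hortonStrahler]

@[simp] theorem hortonStrahler_mirror (t : PlaneTree) :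
    t.mirror.hortonStrahler = t.hortonStrahler := by
  induction t using nodeInduction with
  | h ts ih =>
    rw [mirror_node, hortonStrahler_node, hortonStrahler_node]
    have hp : ((ts.map mirror).reverse.map hortonStrahler).Perm (ts.map hortonStrahler) := by
      refine ((List.reverse_perm _).map _).trans ?_
      rw [List.map_map, List.map_congr_left (g := hortonStrahler) (by simpa using ih)]
    have hm : ((ts.map mirror).reverse.map hortonStrahler).foldr max 0 =
        (ts.map hortonStrahler).foldr max 0 := hp.foldr_eq 0
    rw [hm, hp.count_eq]

theorem foldr_max_le_iff (l : List ℕ) (k : ℕ) : l.foldr max 0 ≤ k ↔ ∀ x ∈ l, x ≤ k := by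
  induction l with
  | nil => simp
  | cons a l ih => simp [ih]

/-- This form avoids the maximum: when all children are below `k`, the possible increment still
gives at most `k`, so only ties at level `k` itself matter. -/
theorem hortonStrahler_node_le_iff (ts : List PlaneTree) (k : ℕ) :
    (node ts).hortonStrahler ≤ k ↔ (∀ t ∈ ts, t.hortonStrahler ≤ k) ∧
      (ts.map hortonStrahler).count k ≤ 1 := by
  rw [hortonStrahler_node]
  set l := ts.map hortonStrahler with hl
  have hmem : (∀ t ∈ ts, t.hortonStrahler ≤ k) ↔ l.foldr max 0 ≤ k := by
    rw [foldr_max_le_iff]; simp [hl]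
  rw [hmem]
  rcases lt_trichotomy (l.foldr max 0) k with h | h | h
  · have h0 : l.count k = 0 := by
      rw [List.count_eq_zero]
      intro hk
      have := (foldr_max_le_iff l _).1 le_rfl k hk
      omega
    rw [h0]
    split_ifs <;> simp <;> omega
  · rw [h]
    split_ifs <;> simp <;> omega
  · constructor
    · intro h'; omega
    · intro h'; omega

end PlaneTree

/-! ### Trees with a distinguished node -/

/-- A tree with a distinguished node: the subtree at that node, and along the path to the root, the
subtrees to the left and to the right of the path. -/
inductive PointedTree : Type
  | here (s : PlaneTree) : PointedTree
  | child (l : List PlaneTree) (z : PointedTree) (r : List PlaneTree) : PointedTree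

namespace PointedTree

open PlaneTree

/-- The underlying tree. -/
def tree : PointedTree → PlaneTree
  | here s => s
  | child l z r => node (l ++ z.tree :: r)

/-- The part of the code before the distinguished node. -/
def before : PointedTree → List ℕ
  | here _ => []
  | child l z r => (l.length + 1 + r.length) :: (forestCode l ++ z.before)

/-- The subtree at the distinguished node and the subtrees to the right of its path. -/
def rightForest : PointedTree → List PlaneTree
  | here s => [s]
  | child _ z r => z.rightForest ++ r

/-- The mirror image. -/
def mirror : PointedTree → PointedTree
  | here s => here s.mirror
  | child l z r => child (r.map PlaneTree.mirror).reverse z.mirror (l.map PlaneTree.mirror).reverse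

@[simp] theorem mirror_mirror (z : PointedTree) : z.mirror.mirror = z := by
  have hm : ∀ l : List PlaneTree, List.map (PlaneTree.mirror ∘ PlaneTree.mirror) l = l := by
    intro l
    conv_rhs => rw [← List.map_id l]
    exact List.map_congr_left (by simp)
  induction z with
  | here s => simp [mirror]
  | child l z r ih => simp [mirror, ih, List.map_reverse, hm]

theorem tree_mirror (z : PointedTree) : z.mirror.tree = z.tree.mirror := by
  induction z with
  | here s => rfl
  | child l z r ih => simp [mirror, tree, mirror_node, ih]

theorem code_tree (z : PointedTree) : z.tree.code = z.before ++ forestCode z.rightForest := by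
  induction z with
  | here s => simp [tree, before, rightForest]
  | child l z r ih =>
    simp [tree, before, rightForest, code_node, ih]; omega

theorem forestCode_rightForest_ne_nil (z : PointedTree) : forestCode z.rightForest ≠ [] := by
  induction z with
  | here s => simp [rightForest, code_ne_nil]
  | child l z r ih => simp [rightForest, ih]

theorem length_before_lt (z : PointedTree) : z.before.length < z.tree.size := by
  have h1 := congrArg List.length z.code_tree
  have h2 := List.length_pos_iff.2 z.forestCode_rightForest_ne_nil
  rw [length_code, List.length_append] at h1
  omega

theorem eq_of_tree_eq {z z' : PointedTree} (h : z.tree = z'.tree)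
    (hlen : z.before.length = z'.before.length) : z = z' := by
  -- If one path branched at a later child than the other, the whole subtree `y.tree` would precede
  -- the second node, whereas fewer than `y.tree.size` of its nodes precede the first.
  have key : ∀ (l l' r r' : List PlaneTree) (y y' : PointedTree),
      l ++ y.tree :: r = l' ++ y'.tree :: r' →
      (forestCode l).length + y.before.length = (forestCode l').length + y'.before.length →
      (∃ c, l' = l ++ c) → l = l' ∧ y.tree = y'.tree ∧ r = r' := by
    rintro l l' r r' y y' h1 h2 ⟨c, rfl⟩
    rcases c with _ | ⟨a, c⟩
    · simpa using h1
    · simp only [List.append_assoc, List.cons_append, List.append_cancel_left_eq,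
        List.cons.injEq] at h1
      have := y.length_before_lt
      rw [h1.1] at this
      simp [length_code] at h2
      omega
  induction z generalizing z' with
  | here s =>
    cases z' with
    | here s' => simpa [tree] using h
    | child l' z' r' => simp [before] at hlen
  | child l z r ih =>
    cases z' with
    | here s' => simp [before] at hlen
    | child l' z' r' =>
      simp only [tree, PlaneTree.node.injEq] at h
      simp only [before, List.length_cons, List.length_append, add_left_inj] at hlen
      obtain ⟨h1, h2, h3⟩ : l = l' ∧ z.tree = z'.tree ∧ r = r' := by
        rcases List.append_eq_append_iff.1 h with ⟨c, hc, -⟩ | ⟨c, hc, -⟩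
        · exact key _ _ _ _ _ _ h hlen ⟨c, hc⟩
        · obtain ⟨h1, h2, h3⟩ := key _ _ _ _ _ _ h.symm hlen.symm ⟨c, hc⟩
          exact ⟨h1.symm, h2.symm, h3.symm⟩
      subst h1 h3
      rw [ih h2 (by omega)]

theorem exists_of_lt_size (t : PlaneTree) (p : ℕ) (hp : p < t.size) :
    ∃ z : PointedTree, z.tree = t ∧ z.before.length = p := by
  induction t using nodeInduction generalizing p with
  | h ts ih =>
    rcases p with _ | p
    · exact ⟨here _, rfl, rfl⟩
    · have key : ∀ (ts : List PlaneTree) (p : ℕ), p < (ts.map size).sum →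
          ∃ l t r, ts = l ++ t :: r ∧ (forestCode l).length ≤ p ∧
            p < (forestCode l).length + t.size := by
        intro ts
        induction ts with
        | nil => intro p hp; simp at hp
        | cons t ts ih =>
          intro p hp
          by_cases h : p < t.size
          · exact ⟨[], t, ts, rfl, by simp, by simpa using h⟩
          · obtain ⟨l, s, r, rfl, h1, h2⟩ := ih (p - t.size) (by simp at hp; omega)
            refine ⟨t :: l, s, r, rfl, ?_, ?_⟩ <;> simp [length_code] <;> omega
      rw [size_node] at hp
      obtain ⟨l, t, r, rfl, h1, h2⟩ := key ts p (by omega)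
      obtain ⟨z, rfl, hz⟩ := ih t (by simp) (p - (forestCode l).length) (by omega)
      exact ⟨child l z r, rfl, by simp [before, hz]; omega⟩

/-- At least half of the nodes of a tree of size `n` have `n / 4` nodes before them, both in
preorder and in the preorder of the mirror image. -/
theorem exists_finset_before_ge (t : PlaneTree) :
    ∃ S : Finset PointedTree, t.size ≤ 2 * S.card ∧ ∀ z ∈ S, z.tree = t ∧
      t.size / 4 ≤ z.before.length ∧ t.size / 4 ≤ z.mirror.before.length := by
  classical
  have : Nonempty PointedTree := ⟨here t⟩
  choose! f hf1 hf2 using exists_of_lt_size t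
  set n := t.size
  set S := (Finset.range n).image f with hS
  have hcard : S.card = n := by
    rw [hS, Finset.card_image_of_injOn, Finset.card_range]
    intro p hp q hq hpq
    rw [← hf2 p (by simpa using hp), hpq, hf2 q (by simpa using hq)]
  have htree : ∀ z ∈ S, z.tree = t := by
    intro z hz
    obtain ⟨p, hp, rfl⟩ := Finset.mem_image.1 hz
    exact hf1 p (by simpa using hp)
  -- Preorder positions are distinct, so at most `n / 4` nodes fail each of the two conditions; this
  -- leaves at least half.
  have hA : (S.filter fun z => z.before.length < n / 4).card ≤ n / 4 := by
    rw [← Finset.card_range (n / 4)]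
    refine Finset.card_le_card_of_injOn (fun z => z.before.length)
      (fun z hz => by simpa using (Finset.mem_filter.1 hz).2) fun z hz y hy h => ?_
    exact eq_of_tree_eq ((htree z (Finset.mem_filter.1 hz).1).trans
      (htree y (Finset.mem_filter.1 hy).1).symm) h
  have hB : (S.filter fun z => z.mirror.before.length < n / 4).card ≤ n / 4 := by
    rw [← Finset.card_range (n / 4)]
    refine Finset.card_le_card_of_injOn (fun z => z.mirror.before.length)
      (fun z hz => by simpa using (Finset.mem_filter.1 hz).2) fun z hz y hy h => ?_
    have := eq_of_tree_eq (z := z.mirror) (z' := y.mirror) (by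
      rw [tree_mirror, tree_mirror, htree z (Finset.mem_filter.1 hz).1,
        htree y (Finset.mem_filter.1 hy).1]) h
    rw [← mirror_mirror z, this, mirror_mirror]
  refine ⟨S.filter fun z => n / 4 ≤ z.before.length ∧ n / 4 ≤ z.mirror.before.length, ?_, ?_⟩
  · have hcov : S ⊆ (S.filter fun z => n / 4 ≤ z.before.length ∧ n / 4 ≤ z.mirror.before.length) ∪
        ((S.filter fun z => z.before.length < n / 4) ∪
          (S.filter fun z => z.mirror.before.length < n / 4)) := by
      intro z hz
      simp only [Finset.mem_union, Finset.mem_filter, hz, true_and]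
      omega
    have h1 := (Finset.card_le_card hcov).trans (Finset.card_union_le _ _)
    have h2 := Finset.card_union_le (S.filter fun z => z.before.length < n / 4)
          (S.filter fun z => z.mirror.before.length < n / 4)
    omega
  · intro z hz
    obtain ⟨h1, h2⟩ := Finset.mem_filter.1 hz
    exact ⟨htree z h1, h2⟩

/-- The word obtained by starting the code at the distinguished node and continuing cyclically. -/
def rotatedCode (z : PointedTree) : List ℕ := forestCode z.rightForest ++ z.before

theorem rotatedCode_injective : Function.Injective rotatedCode := by
  intro z z' h
  obtain ⟨h1, h2⟩ := rotation_unique z.code_tree z'.code_tree z.forestCode_rightForest_ne_nil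
    z'.forestCode_rightForest_ne_nil h
  exact eq_of_tree_eq h1 (by rw [h2])

theorem perm_rotatedCode (z : PointedTree) : z.rotatedCode.Perm z.tree.code := by
  rw [code_tree]; exact List.perm_append_comm

theorem exists_rotatedCode_eq (w : List ℕ) (hw : height w = -1) :
    ∃ z : PointedTree, z.rotatedCode = w := by
  obtain ⟨t, u, v, h1, hv, rfl⟩ := exists_rotation w hw
  have hlen := congrArg List.length h1
  rw [length_code, List.length_append] at hlen
  have := List.length_pos_iff.2 hv
  obtain ⟨z, rfl, hz⟩ := exists_of_lt_size t u.length (by omega)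
  obtain ⟨h2, h3⟩ := List.append_inj (h1.symm.trans z.code_tree) hz.symm
  exact ⟨z, by rw [rotatedCode, ← h2, ← h3]⟩

/-- If the subtrees hanging off the path have Horton-Strahler number less than `k`, then the whole
tree has Horton-Strahler number at most `k`. -/
theorem hortonStrahler_tree_le (z : PointedTree) (k : ℕ)
    (hr : ∀ t ∈ z.rightForest, t.hortonStrahler < k)
    (hl : ∀ t ∈ z.mirror.rightForest, t.hortonStrahler < k) : z.tree.hortonStrahler ≤ k := by
  induction z with
  | here s => exact (hr s (by simp [rightForest])).le
  | child l z r ih =>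
    have hz := ih (fun t ht => hr t (by simp [rightForest, ht]))
      (fun t ht => hl t (by simp [mirror, rightForest, ht]))
    have hl' : ∀ t ∈ l, t.hortonStrahler < k := fun t ht => by
      have := hl t.mirror (by
        simp only [mirror, rightForest, List.mem_append]; right; simpa using ⟨t, ht, rfl⟩)
      simpa using this
    have hr' : ∀ t ∈ r, t.hortonStrahler < k := fun t ht => hr t (by simp [rightForest, ht])
    have h0 : ∀ l : List PlaneTree, (∀ t ∈ l, t.hortonStrahler < k) →
        (l.map hortonStrahler).count k = 0 := by
      intro l h
      rw [List.count_eq_zero]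
      intro hk
      obtain ⟨t, ht, hk⟩ := List.mem_map.1 hk
      have := h t ht
      omega
    rw [tree, hortonStrahler_node_le_iff]
    constructor
    · intro t ht
      simp only [List.mem_append, List.mem_cons] at ht
      rcases ht with ht | rfl | ht
      · exact (hl' t ht).le
      · exact hz
      · exact (hr' t ht).le
    -- Only the child on the path can attain `k`, so there is no tie at level `k`.
    · rw [List.map_append, List.map_cons, List.count_append, List.count_cons, h0 l hl', h0 r hr']
      split_ifs <;> omega

end PointedTree

/-! ### Expectations over words of independent letters -/

section
open scoped ENNReal Classical

/-- The product of the weights of the letters of a word. -/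
noncomputable def wordWeight {α : Type*} (p : α → ℝ≥0∞) (w : List α) : ℝ≥0∞ := (w.map p).prod

/-- The expectation of `F` of a word of `n` independent letters of distribution `p`. -/
noncomputable def wordExp {α : Type*} (p : α → ℝ≥0∞) : ℕ → (List α → ℝ≥0∞) → ℝ≥0∞
  | 0, F => F []
  | n + 1, F => ∑' i, p i * wordExp p n fun y => F (i :: y)

section WordExp

variable {α : Type*} (p : α → ℝ≥0∞)

@[simp] theorem wordWeight_nil : wordWeight p [] = 1 := by simp [wordWeight]

@[simp] theorem wordWeight_cons (a : α) (w : List α) :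
    wordWeight p (a :: w) = p a * wordWeight p w := by simp [wordWeight]

@[simp] theorem wordWeight_append (u v : List α) :
    wordWeight p (u ++ v) = wordWeight p u * wordWeight p v := by simp [wordWeight]

theorem wordWeight_perm {u v : List α} (h : u.Perm v) : wordWeight p u = wordWeight p v :=
  (h.map p).prod_eq

theorem wordExp_mono (n : ℕ) {F G : List α → ℝ≥0∞} (h : ∀ y, y.length = n → F y ≤ G y) :
    wordExp p n F ≤ wordExp p n G := by
  induction n generalizing F G with
  | zero => exact h [] rfl
  | succ n ih =>
    exact ENNReal.tsum_le_tsum fun i => mul_le_mul_right (ih fun y hy => h _ (by simp [hy])) _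

theorem wordExp_congr (n : ℕ) {F G : List α → ℝ≥0∞} (h : ∀ y, y.length = n → F y = G y) :
    wordExp p n F = wordExp p n G :=
  le_antisymm (wordExp_mono p n fun y hy => (h y hy).le) (wordExp_mono p n fun y hy => (h y hy).ge)

theorem wordExp_const_mul (n : ℕ) (c : ℝ≥0∞) (F : List α → ℝ≥0∞) :
    wordExp p n (fun y => c * F y) = c * wordExp p n F := by
  induction n generalizing F with
  | zero => rfl
  | succ n ih =>
    simp only [wordExp, ih]
    rw [← ENNReal.tsum_mul_left]
    exact tsum_congr fun i => mul_left_comm _ _ _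

theorem wordExp_tsum {ι : Type*} (n : ℕ) (F : ι → List α → ℝ≥0∞) :
    wordExp p n (fun y => ∑' j, F j y) = ∑' j, wordExp p n (F j) := by
  induction n generalizing F with
  | zero => rfl
  | succ n ih =>
    simp only [wordExp, ih]
    rw [ENNReal.tsum_comm]
    exact tsum_congr fun i => ENNReal.tsum_mul_left.symm

theorem wordExp_add (n : ℕ) (F G : List α → ℝ≥0∞) :
    wordExp p n (fun y => F y + G y) = wordExp p n F + wordExp p n G := by
  induction n generalizing F G with
  | zero => rfl
  | succ n ih =>
    simp only [wordExp, ih, mul_add]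
    rw [ENNReal.tsum_add]

theorem wordExp_finset_sum {ι : Type*} (n : ℕ) (s : Finset ι) (F : ι → List α → ℝ≥0∞) :
    wordExp p n (fun y => ∑ j ∈ s, F j y) = ∑ j ∈ s, wordExp p n (F j) := by
  induction n generalizing F with
  | zero => rfl
  | succ n ih =>
    simp only [wordExp, ih, Finset.mul_sum]
    rw [Summable.tsum_finsetSum fun _ _ => ENNReal.summable]

theorem wordExp_append (m n : ℕ) (F : List α → ℝ≥0∞) :
    wordExp p (m + n) F = wordExp p m fun x => wordExp p n fun y => F (x ++ y) := by
  induction m generalizing F with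
  | zero => simp [wordExp]
  | succ m ih => rw [Nat.add_right_comm]; simp only [wordExp, ih]; rfl

theorem wordExp_prod (n : ℕ) (h : α → ℝ≥0∞) :
    wordExp p n (fun y => (y.map h).prod) = (∑' i, p i * h i) ^ n := by
  induction n with
  | zero => simp [wordExp]
  | succ n ih =>
    simp only [wordExp, List.map_cons, List.prod_cons]
    simp_rw [wordExp_const_mul, ih, ← mul_assoc]
    rw [ENNReal.tsum_mul_right, pow_succ']

theorem wordExp_const (hp : ∑' i, p i = 1) (n : ℕ) (c : ℝ≥0∞) :
    wordExp p n (fun _ => c) = c := by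
  induction n with
  | zero => rfl
  | succ n ih => simp only [wordExp, ih]; rw [ENNReal.tsum_mul_right, hp, one_mul]

theorem wordExp_prefix_le [DecidableEq α] (n : ℕ) (u : List α) :
    wordExp p n (fun y => if u <+: y then 1 else 0) ≤
      wordWeight p u * (∑' i, p i) ^ (n - u.length) := by
  induction u generalizing n with
  | nil =>
    have := wordExp_prod p n fun _ => 1
    simp only [List.map_const', List.prod_replicate, one_pow, mul_one] at this
    simp [this]
  | cons a u ih =>
    cases n with
    | zero => simp [wordExp]
    | succ n =>
      simp only [wordExp]
      rw [tsum_eq_single a]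
      · simp only [List.cons_prefix_cons, true_and, wordWeight_cons, List.length_cons,
          Nat.add_sub_add_right, mul_assoc]
        exact mul_le_mul_right (ih n) _
      · intro b hb
        simp only [List.cons_prefix_cons, hb.symm, false_and, if_false]
        rw [wordExp_congr p n (G := fun _ => 0 * 0) (by simp), wordExp_const_mul]
        simp

theorem tsum_list (G : List α → ℝ≥0∞) :
    ∑' y, G y = G [] + ∑' i, ∑' y, G (i :: y) := by
  let e : Unit ⊕ (α × List α) ≃ List α :=
    { toFun := fun o => o.elim (fun _ => []) fun x => x.1 :: x.2
      invFun := fun l => match l with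
        | [] => .inl ()
        | i :: y => .inr (i, y)
      left_inv := by rintro (_ | ⟨i, y⟩) <;> rfl
      right_inv := by rintro (_ | ⟨i, y⟩) <;> rfl }
  rw [← e.tsum_eq G, Summable.tsum_sum ENNReal.summable ENNReal.summable, ENNReal.tsum_prod']
  simp [e]

theorem wordExp_eq_tsum (n : ℕ) (F : List α → ℝ≥0∞) :
    wordExp p n F = ∑' y : List α, if y.length = n then wordWeight p y * F y else 0 := by
  induction n generalizing F with
  | zero =>
    rw [tsum_eq_single []]
    · simp [wordExp]
    · intro y hy; simp [hy]
  | succ n ih =>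
    simp only [wordExp, ih]
    rw [tsum_list]
    simp only [List.length_cons, List.length_nil, add_left_inj, wordWeight_cons]
    rw [if_neg (by omega), zero_add]
    refine tsum_congr fun i => ?_
    rw [← ENNReal.tsum_mul_left]
    refine tsum_congr fun y => ?_
    split_ifs <;> simp [mul_assoc]

end WordExp

/-! ### Weights of trees, the cycle lemma, and the cost of conditioning on the size -/

open PlaneTree

/-- The probability that the Galton-Watson tree is `t`. -/
noncomputable def treeWeight (p : ℕ → ℝ≥0∞) (t : PlaneTree) : ℝ≥0∞ := wordWeight p t.code

/-- The probability that `n` independent variables of distribution `p` have sum `s`. -/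
noncomputable def sumProb (p : ℕ → ℝ≥0∞) (n s : ℕ) : ℝ≥0∞ :=
  wordExp p n fun y => if y.sum = s then 1 else 0

/-- The word begins with the code of a forest the last tree of which has Horton-Strahler number at
least `k`. -/
def HasHighTree (k : ℕ) (y : List ℕ) : Prop :=
  ∃ ts t, k ≤ hortonStrahler t ∧ forestCode ts ++ t.code <+: y

section Trees

variable (p : ℕ → ℝ≥0∞)

theorem wordWeight_forestCode (ts : List PlaneTree) :
    wordWeight p (forestCode ts) = wordWeight (treeWeight p) ts := by
  induction ts with
  | nil => simp
  | cons t ts ih => simp [ih, treeWeight]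

theorem treeWeight_node (ts : List PlaneTree) :
    treeWeight p (node ts) = p ts.length * wordWeight (treeWeight p) ts := by
  rw [treeWeight, code_node, wordWeight_cons, wordWeight_forestCode]

/-- Decomposition of the sum over all trees at the root. -/
theorem tsum_tree (F : PlaneTree → ℝ≥0∞) :
    ∑' t, treeWeight p t * F t =
      ∑' i, p i * wordExp (treeWeight p) i fun ts => F (node ts) := by
  let e : List PlaneTree ≃ PlaneTree :=
    { toFun := node
      invFun := fun t => match t with | node ts => ts
      left_inv := fun _ => rfl
      right_inv := fun ⟨_⟩ => rfl }
  rw [← e.tsum_eq]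
  simp_rw [wordExp_eq_tsum, ← ENNReal.tsum_mul_left]
  rw [ENNReal.tsum_comm]
  refine tsum_congr fun ts => ?_
  rw [tsum_eq_single ts.length]
  · simp [e, treeWeight_node, mul_assoc]
  · intro i hi
    simp [hi.symm]

/-- A node is determined by its preorder position, so each tree carries exactly `t.size` marks. -/
theorem tsum_pointedTree (G : PlaneTree → ℝ≥0∞) :
    ∑' z : PointedTree, G z.tree = ∑' t : PlaneTree, (t.size : ℝ≥0∞) * G t := by
  let e : PointedTree → Σ t : PlaneTree, Fin t.size := fun z =>
    ⟨z.tree, ⟨z.before.length, z.length_before_lt⟩⟩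
  have he : Function.Bijective e := by
    constructor
    · intro z z' h
      simp only [e] at h
      rw [Sigma.mk.injEq] at h
      refine PointedTree.eq_of_tree_eq h.1 ?_
      have h2 := h.2
      rw [Fin.heq_ext_iff (by rw [h.1])] at h2
      exact h2
    · rintro ⟨t, q, hq⟩
      obtain ⟨z, rfl, rfl⟩ := PointedTree.exists_of_lt_size t q hq
      exact ⟨z, rfl⟩
  have h1 : ∑' z : PointedTree, G z.tree = ∑' x : Σ t : PlaneTree, Fin t.size, G x.1 :=
    (Equiv.ofBijective e he).tsum_eq fun x => G x.1
  rw [h1, ENNReal.tsum_sigma']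
  simp

theorem size_rotatedCode (z : PointedTree) : z.rotatedCode.length = z.tree.size := by
  rw [z.perm_rotatedCode.length_eq, length_code]

theorem sum_rotatedCode (z : PointedTree) : z.rotatedCode.sum = z.tree.size - 1 := by
  have h := height_code z.tree
  rw [height, length_code] at h
  rw [z.perm_rotatedCode.sum_eq]
  have := z.tree.size_pos
  omega

theorem wordWeight_rotatedCode (z : PointedTree) :
    wordWeight p z.rotatedCode = treeWeight p z.tree :=
  wordWeight_perm p z.perm_rotatedCode

/-- The cycle lemma. -/
theorem sumProb_eq_mul_tsum (n : ℕ) (hn : 0 < n) :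
    sumProb p n (n - 1) = n * ∑' t : PlaneTree, if t.size = n then treeWeight p t else 0 := by
  -- The sum over words is pulled back along `rotatedCode`, which is injective and whose range
  -- contains every word of height `-1`, hence every word with a nonzero term.
  rw [sumProb, wordExp_eq_tsum, ← PointedTree.rotatedCode_injective.tsum_eq]
  · rw [← ENNReal.tsum_mul_left]
    trans ∑' z : PointedTree, if z.tree.size = n then treeWeight p z.tree else 0
    · refine tsum_congr fun z => ?_
      rw [size_rotatedCode, sum_rotatedCode, wordWeight_rotatedCode]
      split_ifs <;> simp_all
    · rw [tsum_pointedTree fun t => if t.size = n then treeWeight p t else 0]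
      refine tsum_congr fun t => ?_
      split_ifs with h <;> simp [h]
  · intro y hy
    simp only [Function.mem_support, ne_eq, ite_eq_right_iff, mul_eq_zero, not_forall,
      not_or] at hy
    obtain ⟨h1, -, h2, -⟩ := hy
    exact PointedTree.exists_rotatedCode_eq y (by rw [height]; omega)

/-- The factor `n` counts marks; restricting to the well-placed half of them costs only the factor
`2`. -/
theorem size_mul_tsum_le (n k : ℕ) :
    (n : ℝ≥0∞) * ∑' t : PlaneTree,
        (if t.size = n ∧ k + 1 ≤ t.hortonStrahler then treeWeight p t else 0) ≤
      2 * ∑' z : PointedTree, if z.tree.size = n ∧ k + 1 ≤ z.tree.hortonStrahler ∧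
        n / 4 ≤ z.before.length ∧ n / 4 ≤ z.mirror.before.length then treeWeight p z.tree else 0 := by
  choose S hS1 hS2 using PointedTree.exists_finset_before_ge
  set G : PointedTree → ℝ≥0∞ := fun z => if z.tree.size = n ∧ k + 1 ≤ z.tree.hortonStrahler ∧
        n / 4 ≤ z.before.length ∧ n / 4 ≤ z.mirror.before.length then treeWeight p z.tree else 0
    with hG
  have h1 : ∑' x : Σ t : PlaneTree, S t, G x.2 ≤ ∑' z, G z := by
    refine ENNReal.tsum_comp_le_tsum_of_injective (f := fun x : Σ t : PlaneTree, S t =>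
      (x.2 : PointedTree)) ?_ G
    rintro ⟨t, z, hz⟩ ⟨t', z', hz'⟩ h
    simp only at h
    subst h
    obtain rfl : t = t' := (hS2 t z hz).1.symm.trans (hS2 t' z hz').1
    rfl
  refine le_trans ?_ (mul_le_mul_right h1 2)
  rw [ENNReal.tsum_sigma', ← ENNReal.tsum_mul_left, ← ENNReal.tsum_mul_left]
  refine ENNReal.tsum_le_tsum fun t => ?_
  split_ifs with h
  · have hz : ∀ z : S t, G z = treeWeight p t := by
      rintro ⟨z, hz⟩
      obtain ⟨h2, h3, h4⟩ := hS2 t z hz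
      simp only [hG, h2, h.1, h.2, true_and]
      rw [h.1] at h3 h4
      simp [h3, h4]
    simp only [hz]
    rw [tsum_fintype, Finset.sum_const, Finset.card_univ, Fintype.card_coe, nsmul_eq_mul, ← mul_assoc]
    gcongr
    have := hS1 t
    rw [h.1] at this
    exact_mod_cast this
  · simp

/-- Bound for the weight of the trees of size `n` with large Horton-Strahler number. -/
theorem size_mul_tsum_high_le (n k : ℕ) (hn : 0 < n) :
    (n : ℝ≥0∞) * ∑' t : PlaneTree,
        (if t.size = n ∧ k + 1 ≤ t.hortonStrahler then treeWeight p t else 0) ≤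
      4 * (wordExp p (n - n / 4) fun y => if HasHighTree k y then 1 else 0) *
        ⨆ s, sumProb p (n / 4) s := by
  -- `R` records a high tree in the right forest. The left side is the right side of the mirror
  -- image, and mirroring is a weight-preserving involution, whence the second factor `2`.
  set R : PointedTree → ℝ≥0∞ := fun z => if z.tree.size = n ∧ n / 4 ≤ z.before.length ∧
    ∃ t ∈ z.rightForest, k ≤ t.hortonStrahler then treeWeight p z.tree else 0 with hR
  have hmir : ∑' z : PointedTree, R z.mirror = ∑' z, R z :=
    (Equiv.tsum_eq ⟨PointedTree.mirror, PointedTree.mirror, PointedTree.mirror_mirror,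
      PointedTree.mirror_mirror⟩ R)
  have h1 : (∑' z : PointedTree, if z.tree.size = n ∧ k + 1 ≤ z.tree.hortonStrahler ∧
        n / 4 ≤ z.before.length ∧ n / 4 ≤ z.mirror.before.length then treeWeight p z.tree else 0) ≤
      2 * ∑' z, R z := by
    rw [two_mul]
    nth_rewrite 2 [← hmir]
    rw [← ENNReal.tsum_add]
    refine ENNReal.tsum_le_tsum fun z => ?_
    split_ifs with h
    · obtain ⟨h1, h2, h3, h4⟩ := h
      have hex : (∃ t ∈ z.rightForest, k ≤ t.hortonStrahler) ∨
          ∃ t ∈ z.mirror.rightForest, k ≤ t.hortonStrahler := by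
        by_contra! hcon
        have := z.hortonStrahler_tree_le k hcon.1 hcon.2
        omega
      rcases hex with hex | hex
      · refine le_trans ?_ le_self_add
        simp only [hR]
        rw [if_pos ⟨h1, h3, hex⟩]
      · refine le_trans ?_ le_add_self
        simp only [hR]
        rw [if_pos ⟨by rw [PointedTree.tree_mirror, size_mirror, h1], h4, hex⟩,
          PointedTree.tree_mirror, treeWeight, treeWeight, wordWeight_perm p (perm_code_mirror _)]
    · exact zero_le
  have h2 : ∑' z, R z ≤ (wordExp p (n - n / 4) fun y => if HasHighTree k y then 1 else 0) *
        ⨆ s, sumProb p (n / 4) s := by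
    set M := n - n / 4 with hM
    calc ∑' z, R z ≤ ∑' z : PointedTree, (fun y : List ℕ => if y.length = M + n / 4 then
            wordWeight p y * (if HasHighTree k (y.take M) ∧ y.sum = n - 1 then 1 else 0) else 0)
            z.rotatedCode := by
          refine ENNReal.tsum_le_tsum fun z => ?_
          simp only [hR]
          by_cases h : z.tree.size = n ∧ n / 4 ≤ z.before.length ∧
            ∃ t ∈ z.rightForest, k ≤ t.hortonStrahler
          · obtain ⟨h1, h2, t, ht, hk⟩ := id h
            -- At least `n / 4` letters precede the marked node, so the code of its right forest
            -- fits into the first `M` letters of the rotated word.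
            have hhigh : HasHighTree k (z.rotatedCode.take M) := by
              obtain ⟨l, r, hlr⟩ := List.append_of_mem ht
              refine ⟨l, t, hk, ?_⟩
              have hlen := congrArg List.length z.code_tree
              rw [length_code, List.length_append] at hlen
              have hfl : (forestCode l ++ t.code).length ≤ (forestCode z.rightForest).length := by
                rw [hlr]; simp
              refine List.prefix_take_iff.2 ⟨?_, by omega⟩
              rw [PointedTree.rotatedCode, hlr]
              simp
            rw [if_pos h, if_pos (by rw [size_rotatedCode]; omega),
              if_pos ⟨hhigh, by rw [sum_rotatedCode, h1]⟩, mul_one, wordWeight_rotatedCode]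
          · rw [if_neg h]
            exact zero_le
      _ ≤ ∑' y : List ℕ, (fun y : List ℕ => if y.length = M + n / 4 then
            wordWeight p y * (if HasHighTree k (y.take M) ∧ y.sum = n - 1 then 1 else 0) else 0) y :=
          ENNReal.tsum_comp_le_tsum_of_injective PointedTree.rotatedCode_injective _
      _ = wordExp p M fun x => wordExp p (n / 4) fun y =>
            if HasHighTree k ((x ++ y).take M) ∧ (x ++ y).sum = n - 1 then 1 else 0 := by
          rw [← wordExp_append p M (n / 4) fun w =>
            if HasHighTree k (w.take M) ∧ w.sum = n - 1 then 1 else 0, wordExp_eq_tsum]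
      -- Once the first `M` letters are fixed, the last `n / 4` must have one prescribed sum, an
      -- event of probability at most the supremum whatever the first letters are.
      _ ≤ wordExp p M fun x => (⨆ s, sumProb p (n / 4) s) * if HasHighTree k x then 1 else 0 := by
          refine wordExp_mono p M fun x hx => ?_
          simp only [← hx, List.take_left, List.sum_append]
          split_ifs with h
          · rw [mul_one]
            refine le_trans ?_ (le_iSup _ (n - 1 - x.sum))
            refine wordExp_mono p _ fun y _ => ?_
            split_ifs with h1 h2 <;> first | exact zero_le | skip
            · exact le_rfl
            · omega
          · simp only [h, false_and, if_false]
            rw [wordExp_congr p _ (G := fun _ => 0 * 0) (by simp), wordExp_const_mul]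
            simp
      _ = _ := by rw [wordExp_const_mul, mul_comm]
  calc _ ≤ _ := size_mul_tsum_le p n k
    _ ≤ 2 * (2 * ((wordExp p (n - n / 4) fun y => if HasHighTree k y then 1 else 0) *
        ⨆ s, sumProb p (n / 4) s)) := by gcongr; exact h1.trans (by gcongr)
    _ = _ := by rw [← mul_assoc, ← mul_assoc]; norm_num

/-- The weight of the trees with Horton-Strahler number at least `k`. -/
noncomputable def highWeight (p : ℕ → ℝ≥0∞) (k : ℕ) : ℝ≥0∞ :=
  ∑' t : PlaneTree, if k ≤ t.hortonStrahler then treeWeight p t else 0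

/-- Union bound over the rank `r` of the high tree. For `r < R`, the `r` trees before it have total
weight at most `1` and the high tree contributes `highWeight`; for `r ≥ R`, the path has reached
level `-R` or lower at some time `j ≤ M`. -/
theorem wordExp_hasHighTree_le (hp : ∑' i, p i = 1) (hw : ∑' t, treeWeight p t ≤ 1) (M k R : ℕ) :
    (wordExp p M fun y => if HasHighTree k y then 1 else 0) ≤ R * highWeight p k +
      ∑ j ∈ Finset.range (M + 1), wordExp p j fun y => if height y ≤ -R then 1 else 0 := by
  set A : ℕ → List PlaneTree → PlaneTree → List ℕ → ℝ≥0∞ := fun r ts t y =>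
    (if ts.length = r ∧ k ≤ t.hortonStrahler then 1 else 0) *
      (if forestCode ts ++ t.code <+: y then 1 else 0) with hA
  calc (wordExp p M fun y => if HasHighTree k y then 1 else 0)
      ≤ wordExp p M fun y => (∑ r ∈ Finset.range R, ∑' ts, ∑' t, A r ts t y) +
          ∑ j ∈ Finset.range (M + 1), if height (y.take j) ≤ -R then 1 else 0 := by
        refine wordExp_mono p M fun y hy => ?_
        split_ifs with h
        · obtain ⟨ts, t, hk, hpre⟩ := h
          by_cases hR : ts.length < R
          · refine le_trans ?_ le_self_add
            refine le_trans ?_ (Finset.single_le_sum (fun _ _ => zero_le)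
              (Finset.mem_range.2 hR))
            refine le_trans ?_ (ENNReal.le_tsum ts)
            refine le_trans ?_ (ENNReal.le_tsum t)
            simp [hA, hk, hpre]
          · refine le_trans ?_ le_add_self
            have hpre' : forestCode ts <+: y := (List.prefix_append _ _).trans hpre
            have hlen := hpre'.length_le
            refine le_trans ?_ (Finset.single_le_sum (fun _ _ => zero_le)
              (Finset.mem_range.2 (show (forestCode ts).length < M + 1 by omega)))
            rw [← List.prefix_iff_eq_take.1 hpre', height_forestCode, if_pos (by omega)]
        · exact zero_le
    _ = (∑ r ∈ Finset.range R, ∑' ts, ∑' t, wordExp p M (A r ts t)) +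
          ∑ j ∈ Finset.range (M + 1),
            wordExp p M fun y => if height (y.take j) ≤ -R then 1 else 0 := by
        rw [wordExp_add, wordExp_finset_sum, wordExp_finset_sum]
        simp_rw [wordExp_tsum]
    _ ≤ (∑ r ∈ Finset.range R, highWeight p k) +
          ∑ j ∈ Finset.range (M + 1), wordExp p j fun y => if height y ≤ -R then 1 else 0 := by
        gcongr with r hr j hj
        · calc ∑' ts, ∑' t, wordExp p M (A r ts t)
              ≤ ∑' ts : List PlaneTree, ∑' t, (if ts.length = r then
                  wordWeight (treeWeight p) ts * 1 else 0) *
                  (if k ≤ t.hortonStrahler then treeWeight p t else 0) := by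
                refine ENNReal.tsum_le_tsum fun ts => ENNReal.tsum_le_tsum fun t => ?_
                simp only [hA]
                rw [wordExp_const_mul]
                have := wordExp_prefix_le p M (forestCode ts ++ t.code)
                rw [hp, one_pow, mul_one, wordWeight_append, wordWeight_forestCode,
                  ← treeWeight] at this
                by_cases h1 : ts.length = r ∧ k ≤ t.hortonStrahler
                · simpa [h1.1, h1.2] using this
                · simp [h1]
            _ = (∑' t, treeWeight p t) ^ r * highWeight p k := by
                have h := wordExp_prod (treeWeight p) r fun _ => 1
                simp only [List.map_const', List.prod_replicate, one_pow, mul_one] at h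
                rw [← h, wordExp_eq_tsum, highWeight, ← ENNReal.tsum_mul_right]
                simp_rw [ENNReal.tsum_mul_left]
            _ ≤ 1 ^ r * highWeight p k := by gcongr
            _ = highWeight p k := by simp
        -- The event concerns the first `j` letters only; the other `m` integrate to `1`.
        · obtain ⟨m, rfl⟩ : ∃ m, M = j + m := ⟨M - j, by simp at hj; omega⟩
          rw [wordExp_append]
          refine wordExp_mono p j fun x hx => ?_
          simp only [← hx, List.take_left]
          rw [wordExp_const p hp]
    _ = _ := by simp

/-- Chernoff's bound: the indicator is dominated by `exp (-c * (height y + R))`, which factors over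
the letters. -/
theorem wordExp_height_le (j R : ℕ) {c : ℝ} (hc : 0 ≤ c) :
    (wordExp p j fun y => if height y ≤ -R then 1 else 0) ≤
      ENNReal.ofReal (Real.exp (-c * R)) *
        (∑' i : ℕ, p i * ENNReal.ofReal (Real.exp (-c * (i - 1)))) ^ j := by
  rw [← wordExp_prod, ← wordExp_const_mul]
  refine wordExp_mono p j fun y _ => ?_
  have hprod : ∀ y : List ℕ, (y.map fun i : ℕ => ENNReal.ofReal (Real.exp (-c * (i - 1)))).prod =
      ENNReal.ofReal (Real.exp (-c * height y)) := by
    intro y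
    induction y with
    | nil => simp
    | cons d y ih =>
      rw [List.map_cons, List.prod_cons, ih, ← ENNReal.ofReal_mul (Real.exp_nonneg _),
        ← Real.exp_add, height_cons]
      push_cast
      congr 2; ring
  rw [hprod, ← ENNReal.ofReal_mul (Real.exp_nonneg _), ← Real.exp_add]
  split_ifs with h
  · rw [ENNReal.one_le_ofReal, Real.one_le_exp_iff]
    have : (height y : ℝ) ≤ -R := by exact_mod_cast h
    nlinarith
  · exact zero_le

end Trees

end

/-! ### The recursion for the law of the Horton–Strahler number -/

section
open scoped ENNReal Classical
open PlaneTree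

section Recursion

variable (p : ℕ → ℝ≥0∞)

/-- The weight of the trees with Horton-Strahler number less than `k`. -/
noncomputable def lowWeight (k : ℕ) : ℝ≥0∞ :=
  ∑' t : PlaneTree, if t.hortonStrahler < k then treeWeight p t else 0

/-- The weight of the trees with Horton-Strahler number `k`. -/
noncomputable def levelWeight (k : ℕ) : ℝ≥0∞ :=
  ∑' t : PlaneTree, if t.hortonStrahler = k then treeWeight p t else 0

theorem lowWeight_add_highWeight (k : ℕ) :
    lowWeight p k + highWeight p k = ∑' t, treeWeight p t := by
  rw [lowWeight, highWeight, ← ENNReal.tsum_add]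
  refine tsum_congr fun t => ?_
  by_cases h : t.hortonStrahler < k
  · simp [h, not_le.2 h]
  · simp [h, not_lt.1 h]

theorem lowWeight_succ (k : ℕ) : lowWeight p (k + 1) = lowWeight p k + levelWeight p k := by
  rw [lowWeight, lowWeight, levelWeight, ← ENNReal.tsum_add]
  refine tsum_congr fun t => ?_
  rcases lt_trichotomy t.hortonStrahler k with h | h | h
  · simp [h, h.ne, h.trans (Nat.lt_succ_self k)]
  · simp [h]
  · simp [h.ne', not_lt.2 h.le, not_lt.2 (Nat.succ_le_of_lt h)]

theorem wordExp_treeWeight_low (k i : ℕ) :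
    (wordExp (treeWeight p) i fun ts => if ∀ t ∈ ts, t.hortonStrahler < k then 1 else 0) =
      lowWeight p k ^ i := by
  have h := wordExp_prod (treeWeight p) i fun t => if t.hortonStrahler < k then 1 else 0
  simp only [mul_ite, mul_one, mul_zero] at h
  rw [lowWeight, ← h]
  refine wordExp_congr _ _ fun ts _ => ?_
  clear h
  induction ts generalizing i with
  | nil => simp
  | cons t ts ih =>
    rw [List.map_cons, List.prod_cons, ← ih _ rfl]
    by_cases h : t.hortonStrahler < k <;> simp [h]

/-- Either all `i` children are below `k`, or exactly one of them, in one of `i` positions, is at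
level `k`. -/
theorem wordExp_treeWeight_node_le (k i : ℕ) :
    (wordExp (treeWeight p) i fun ts => if (node ts).hortonStrahler ≤ k then 1 else 0) =
      lowWeight p k ^ i + i * lowWeight p k ^ (i - 1) * levelWeight p k := by
  induction i with
  | zero => simp [wordExp, hortonStrahler_leaf]
  | succ i ih =>
    -- Split by the first child: below `k` it imposes nothing on the others, at `k` it forces all
    -- the others below `k`, and above `k` it is excluded.
    have hstep : ∀ t : PlaneTree,
        (wordExp (treeWeight p) i fun ts =>
          if (node (t :: ts)).hortonStrahler ≤ k then 1 else 0) =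
        (if t.hortonStrahler < k then 1 else 0) *
          (wordExp (treeWeight p) i fun ts => if (node ts).hortonStrahler ≤ k then 1 else 0) +
        (if t.hortonStrahler = k then 1 else 0) * lowWeight p k ^ i := by
      intro t
      rw [← wordExp_treeWeight_low, ← wordExp_const_mul, ← wordExp_const_mul, ← wordExp_add]
      refine wordExp_congr _ _ fun ts _ => ?_
      simp only [hortonStrahler_node_le_iff, List.map_cons, List.count_cons, List.mem_cons,
        forall_eq_or_imp]
      rcases lt_trichotomy t.hortonStrahler k with h | h | h
      · simp [h, h.le, h.ne]
      · have : ((∀ t ∈ ts, t.hortonStrahler ≤ k) ∧ (ts.map hortonStrahler).count k = 0) ↔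
            ∀ t ∈ ts, t.hortonStrahler < k := by
          rw [List.count_eq_zero]
          constructor
          · rintro ⟨h1, h2⟩ t ht
            exact lt_of_le_of_ne (h1 t ht) fun h => h2 (List.mem_map.2 ⟨t, ht, h⟩)
          · intro h1
            refine ⟨fun t ht => (h1 t ht).le, fun h2 => ?_⟩
            obtain ⟨t, ht, h3⟩ := List.mem_map.1 h2
            exact (h1 t ht).ne h3
        simp [h, this]
      · simp [h.ne', not_lt.2 h.le, not_le.2 h]
    simp only [wordExp, hstep, mul_add, ← mul_assoc, mul_ite, mul_one, mul_zero]
    rw [ENNReal.tsum_add, ENNReal.tsum_mul_right, ENNReal.tsum_mul_right, ih, ← lowWeight,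
      ← levelWeight]
    rcases i with _ | i
    · simp
    · simp only [Nat.add_sub_cancel, Nat.cast_add, Nat.cast_one]
      ring

/-- Since `levelWeight p k` is the increment of `lowWeight`, this is Newton's rule `L' = f(L) +
f'(L) (L' - L)` for the equation `f(s) = s`. -/
theorem lowWeight_succ_eq_tsum (k : ℕ) :
    lowWeight p (k + 1) = ∑' i, p i * (lowWeight p k ^ i +
      i * lowWeight p k ^ (i - 1) * levelWeight p k) := by
  have h := tsum_tree p fun t => if t.hortonStrahler < k + 1 then 1 else 0
  simp only [mul_ite, mul_one, mul_zero] at h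
  rw [lowWeight, h]
  simp_rw [Nat.lt_succ_iff, wordExp_treeWeight_node_le]

end Recursion

/-! ### Second-order bounds for powers of `1 - q` -/

section Elementary

/-- The Taylor remainder of `(1 - q) ^ i` obeys a recursion in `i` with nonnegative source; the
lower bounds below follow from it. -/
theorem one_sub_pow_succ_sub (q : ℝ) (i : ℕ) :
    (1 - q) ^ (i + 1) - 1 + (i + 1 : ℕ) * q =
      (1 - q) * ((1 - q) ^ i - 1 + i * q) + i * q ^ 2 := by
  push_cast; ring

theorem one_sub_pow_sub_nonneg {q : ℝ} (h1 : q ≤ 1) (i : ℕ) :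
    0 ≤ (1 - q) ^ i - 1 + i * q := by
  induction i with
  | zero => simp
  | succ i ih =>
    rw [one_sub_pow_succ_sub]
    have : 0 ≤ 1 - q := by linarith
    positivity

theorem sq_le_one_sub_pow_sub {q : ℝ} (h1 : q ≤ 1) {i : ℕ} (hi : 2 ≤ i) :
    q ^ 2 ≤ (1 - q) ^ i - 1 + i * q := by
  obtain ⟨i, rfl⟩ : ∃ j, i = j + 1 := ⟨i - 1, by omega⟩
  rw [one_sub_pow_succ_sub]
  have h2 := mul_nonneg (sub_nonneg.2 h1) (one_sub_pow_sub_nonneg h1 i)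
  have h3 : (1 : ℝ) ≤ i := by exact_mod_cast (by omega : 1 ≤ i)
  nlinarith [mul_nonneg (sub_nonneg.2 h3) (sq_nonneg q)]

theorem choose_two_mul_le_one_sub_pow_sub {q : ℝ} (h0 : 0 ≤ q) (h1 : q ≤ 1) (i : ℕ) :
    q ^ 2 * ((i * (i - 1) / 2 : ℝ) * (1 - q) ^ i) ≤ (1 - q) ^ i - 1 + i * q := by
  induction i with
  | zero => simp
  | succ i ih =>
    rw [one_sub_pow_succ_sub]
    have h2 := mul_le_mul_of_nonneg_left ih (sub_nonneg.2 h1)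
    have h3 : (1 - q) ^ (i + 1) ≤ 1 := pow_le_one₀ (by linarith) (by linarith)
    have h4 : 0 ≤ (i : ℝ) * q ^ 2 * (1 - (1 - q) ^ (i + 1)) :=
      mul_nonneg (by positivity) (by linarith)
    push_cast
    rw [pow_succ (1 - q) i] at h4 ⊢
    linarith

theorem mul_one_sub_pow_le {q : ℝ} (h1 : q ≤ 1) (i : ℕ) :
    i * (1 - (1 - q) ^ (i - 1)) ≤ q * (i * (i - 1) : ℝ) := by
  rcases i with _ | i
  · simp
  · have := one_add_mul_le_pow (a := -q) (by linarith) i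
    rw [← sub_eq_add_neg] at this
    have h2 : (0 : ℝ) ≤ ((i + 1 : ℕ) : ℝ) := by positivity
    have h3 := mul_le_mul_of_nonneg_left
      (show 1 - (1 - q) ^ i ≤ i * q by linarith) h2
    simp only [Nat.add_sub_cancel]
    push_cast at h3 ⊢
    linarith

end Elementary

/-! ### Newton's iteration at a double root -/

section Newton

variable (ν : Measure ℕ) [IsProbabilityMeasure ν]

/-- The second factorial moment. -/
noncomputable def factorialMoment : ℝ := ∫ i : ℕ, (i * (i - 1) : ℝ) ∂ν

variable {ν}

theorem integrable_nat (hL2 : MemLp (fun k : ℕ => (k : ℝ)) 2 ν) :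
    Integrable (fun k : ℕ => (k : ℝ)) ν := hL2.integrable (by norm_num)

theorem integrable_factorial (hL2 : MemLp (fun k : ℕ => (k : ℝ)) 2 ν) :
    Integrable (fun i : ℕ => (i * (i - 1) : ℝ)) ν := by
  have := hL2.integrable_sq.sub (integrable_nat hL2)
  refine this.congr (ae_of_all _ fun i => ?_)
  simp; ring

theorem variance_eq_factorialMoment (hL2 : MemLp (fun k : ℕ => (k : ℝ)) 2 ν)
    (hmean : ∫ k : ℕ, (k : ℝ) ∂ν = 1) :
    variance (fun k : ℕ => (k : ℝ)) ν = factorialMoment ν := by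
  rw [variance_eq_sub hL2, hmean, factorialMoment]
  have : ∀ i : ℕ, (i * (i - 1) : ℝ) = (i : ℝ) ^ 2 - i := fun i => by ring
  simp_rw [this]
  rw [integral_sub hL2.integrable_sq (integrable_nat hL2), hmean]
  simp

theorem factorial_nonneg (i : ℕ) : (0 : ℝ) ≤ i * (i - 1) := by
  rcases i with _ | i
  · simp
  · push_cast; simp; positivity

theorem integrable_one_sub_pow {q : ℝ} (h0 : 0 ≤ q) (h1 : q ≤ 1) :
    Integrable (fun i : ℕ => (1 - q) ^ i) ν := by
  refine (integrable_const (1 : ℝ)).mono' (by fun_prop) (ae_of_all _ fun i => ?_)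
  rw [Real.norm_eq_abs, abs_of_nonneg (pow_nonneg (by linarith) _)]
  exact pow_le_one₀ (by linarith) (by linarith)

theorem integrable_mul_one_sub_pow (hL2 : MemLp (fun k : ℕ => (k : ℝ)) 2 ν) {q : ℝ} (h0 : 0 ≤ q)
    (h1 : q ≤ 1) : Integrable (fun i : ℕ => i * (1 - q) ^ (i - 1)) ν := by
  refine (integrable_nat hL2).mono' (by fun_prop) (ae_of_all _ fun i => ?_)
  rw [Real.norm_eq_abs, abs_of_nonneg (mul_nonneg (by positivity) (pow_nonneg (by linarith) _))]
  exact mul_le_of_le_one_right (by positivity) (pow_le_one₀ (by linarith) (by linarith))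

theorem integrable_factorial_mul_pow (hL2 : MemLp (fun k : ℕ => (k : ℝ)) 2 ν) {q : ℝ}
    (h0 : 0 ≤ q) (h1 : q ≤ 1) :
    Integrable (fun i : ℕ => (i * (i - 1) / 2 : ℝ) * (1 - q) ^ i) ν := by
  refine ((integrable_factorial hL2).div_const 2).mono' (by fun_prop) (ae_of_all _ fun i => ?_)
  have := factorial_nonneg i
  rw [Real.norm_eq_abs, abs_of_nonneg (mul_nonneg (by positivity) (pow_nonneg (by linarith) _))]
  exact mul_le_of_le_one_right (by positivity) (pow_le_one₀ (by linarith) (by linarith))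

/-- One step of Newton's iteration for the fixed point `1` of the generating function. -/
theorem newton_step (hL2 : MemLp (fun k : ℕ => (k : ℝ)) 2 ν)
    (hmean : ∫ k : ℕ, (k : ℝ) ∂ν = 1) {q q' : ℝ} (h0 : 0 ≤ q) (h1 : q ≤ 1) (hq' : q' ≤ q)
    (h : 1 - q' = ∫ i : ℕ, ((1 - q) ^ i + i * (1 - q) ^ (i - 1) * (q - q')) ∂ν) :
    q' * factorialMoment ν ≤ q * (factorialMoment ν - ν.real {i | 2 ≤ i}) ∧
      q' * factorialMoment ν ≤ q * (factorialMoment ν -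
        ∫ i : ℕ, (i * (i - 1) / 2 : ℝ) * (1 - q) ^ i ∂ν) := by
  have hI1 := integrable_one_sub_pow (ν := ν) h0 h1
  have hI2 := integrable_mul_one_sub_pow hL2 h0 h1
  have hI3 := integrable_nat hL2
  have hI4 := integrable_factorial hL2
  have hI5 := integrable_factorial_mul_pow hL2 h0 h1
  have hI6 : Integrable (fun i : ℕ => (1 - q) ^ i - 1) ν := hI1.sub (integrable_const 1)
  have hIG : Integrable (fun i : ℕ => (1 - q) ^ i - 1 + i * q) ν := hI6.add (hI3.mul_const q)
  set G := ∫ i : ℕ, ((1 - q) ^ i - 1 + i * q) ∂ν with hG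
  set D := ∫ i : ℕ, (i * (1 - (1 - q) ^ (i - 1)) : ℝ) ∂ν with hD
  have hG' : G = (∫ i : ℕ, (1 - q) ^ i ∂ν) - 1 + q := by
    rw [hG, integral_add hI6 (hI3.mul_const q),
      integral_sub hI1 (integrable_const 1), integral_mul_const, hmean]
    simp
  have hD' : D = 1 - ∫ i : ℕ, i * (1 - q) ^ (i - 1) ∂ν := by
    rw [hD]
    simp_rw [mul_sub, mul_one]
    rw [integral_sub hI3 hI2, hmean]
  -- With `f` the generating function, `G = f(1 - q) - (1 - q)` and `D = 1 - f'(1 - q)`; the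
  -- hypothesis is Newton's relation between them.
  have hGD : G = (q - q') * D := by
    rw [integral_add hI1 (hI2.mul_const _), integral_mul_const] at h
    rw [hG', hD']
    linarith
  have hDle : D ≤ q * factorialMoment ν := by
    rw [hD, factorialMoment, ← integral_const_mul]
    refine integral_mono ?_ (hI4.const_mul q) fun i => mul_one_sub_pow_le h1 i
    simp_rw [mul_sub, mul_one]
    exact hI3.sub hI2
  -- From `q ^ 2 * c ≤ G = (q - q') * D` and `D ≤ q * f''(1)`, cancel one factor `q`; the case `q =
  -- 0` must be treated apart.
  have key : ∀ c : ℝ, q ^ 2 * c ≤ G → q' * factorialMoment ν ≤ q * (factorialMoment ν - c) := by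
    intro c hc
    rcases h0.eq_or_lt with rfl | hq
    · have : 0 ≤ factorialMoment ν := integral_nonneg factorial_nonneg
      nlinarith
    · have h2 := mul_le_mul_of_nonneg_left hDle (sub_nonneg.2 hq')
      have h3 : q * (q * c) ≤ q * ((q - q') * factorialMoment ν) := by
        rw [hGD] at hc; nlinarith
      have := le_of_mul_le_mul_left h3 hq
      linarith
  refine ⟨key _ ?_, key _ ?_⟩
  · have hm : MeasurableSet {i : ℕ | 2 ≤ i} := MeasurableSet.of_discrete
    have : q ^ 2 * ν.real {i | 2 ≤ i} = ∫ i : ℕ, {i : ℕ | 2 ≤ i}.indicator (fun _ => q ^ 2) i ∂ν := by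
      rw [integral_indicator_const _ hm, smul_eq_mul, mul_comm]
    rw [this]
    refine integral_mono ((integrable_const _).indicator hm) hIG fun i => ?_
    by_cases hi : 2 ≤ i
    · simpa [Set.indicator_apply, hi] using sq_le_one_sub_pow_sub h1 hi
    · simpa [Set.indicator_apply, hi] using one_sub_pow_sub_nonneg h1 i
  · rw [← integral_const_mul]
    exact integral_mono (hI5.const_mul _) hIG fun i => choose_two_mul_le_one_sub_pow_sub h0 h1 i

theorem measureReal_two_le_pos (hpos : 0 < factorialMoment ν) : 0 < ν.real {i | 2 ≤ i} := by
  rw [measureReal_def, ENNReal.toReal_pos_iff]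
  refine ⟨pos_iff_ne_zero.2 fun h => hpos.ne' ?_, measure_lt_top _ _⟩
  refine integral_eq_zero_of_ae ?_
  rw [Filter.EventuallyEq, ae_iff]
  refine measure_mono_null (fun i hi => ?_) h
  by_contra hcon
  simp only [Set.mem_ofPred_eq, not_le] at hcon
  apply hi
  interval_cases i <;> simp

/-- This is what turns the second bound of `newton_step` into an asymptotic contraction by one half.
-/
theorem tendsto_newton_ratio (hL2 : MemLp (fun k : ℕ => (k : ℝ)) 2 ν) {q : ℕ → ℝ}
    (h0 : ∀ k, 0 ≤ q k) (h1 : ∀ k, q k ≤ 1) (hq : Tendsto q atTop (𝓝 0)) :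
    Tendsto (fun k => ∫ i : ℕ, (i * (i - 1) / 2 : ℝ) * (1 - q k) ^ i ∂ν) atTop
      (𝓝 (factorialMoment ν / 2)) := by
  have : factorialMoment ν / 2 = ∫ i : ℕ, (i * (i - 1) / 2 : ℝ) ∂ν := by
    rw [integral_div, factorialMoment]
  rw [this]
  refine tendsto_integral_of_dominated_convergence (fun i : ℕ => (i * (i - 1) / 2 : ℝ))
    (fun k => by fun_prop) ((integrable_factorial hL2).div_const 2)
    (fun k => ae_of_all _ fun i => ?_) (ae_of_all _ fun i => ?_)
  · have := factorial_nonneg i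
    rw [Real.norm_eq_abs, abs_of_nonneg (mul_nonneg (by positivity)
      (pow_nonneg (by linarith [h1 k]) _))]
    exact mul_le_of_le_one_right (by positivity) (pow_le_one₀ (by linarith [h1 k])
      (by linarith [h0 k]))
  · have := ((hq.const_sub 1).pow i).const_mul (i * (i - 1) / 2 : ℝ)
    simpa using this

/-- The crude contraction by `1 - c / s` forces `q` to `0`. The sharp bound then has ratio tending
to `1/2`, so it is eventually at most `θ`, and the constant absorbs the initial steps. -/
theorem newton_decay (hL2 : MemLp (fun k : ℕ => (k : ℝ)) 2 ν)
    (hmean : ∫ k : ℕ, (k : ℝ) ∂ν = 1) (hpos : 0 < factorialMoment ν) {q : ℕ → ℝ}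
    (h0 : ∀ k, 0 ≤ q k) (h1 : ∀ k, q k ≤ 1) (hanti : ∀ k, q (k + 1) ≤ q k)
    (hrec : ∀ k, 1 - q (k + 1) =
      ∫ i : ℕ, ((1 - q k) ^ i + i * (1 - q k) ^ (i - 1) * (q k - q (k + 1))) ∂ν)
    {θ : ℝ} (hθ : 1 / 2 < θ) (hθ1 : θ < 1) : ∃ C : ℝ, 0 < C ∧ ∀ k, q k ≤ C * θ ^ k := by
  have hstep := fun k => newton_step hL2 hmean (h0 k) (h1 k) (hanti k) (hrec k)
  have hc := measureReal_two_le_pos hpos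
  set c := ν.real {i : ℕ | 2 ≤ i}
  set s := factorialMoment ν
  have hlim : Tendsto q atTop (𝓝 0) := by
    -- The maximum with `0` keeps the ratio nonnegative without comparing `c` and `s`.
    have hρ : ∀ k, q k ≤ max (1 - c / s) 0 ^ k := by
      intro k
      induction k with
      | zero => simpa using h1 0
      | succ k ih =>
        have : q (k + 1) ≤ q k * (1 - c / s) := by
          rw [← mul_le_mul_iff_left₀ hpos]
          refine (hstep k).1.trans (le_of_eq ?_)
          field_simp
        refine this.trans ?_
        rw [pow_succ]
        refine (mul_le_mul_of_nonneg_left (le_max_left _ 0) (h0 k)).trans ?_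
        exact mul_le_mul_of_nonneg_right ih (le_max_right _ _)
    refine squeeze_zero h0 hρ (tendsto_pow_atTop_nhds_zero_of_lt_one (le_max_right _ _) ?_)
    have : 0 < c / s := by positivity
    exact max_lt (by linarith) one_pos
  have hJ := tendsto_newton_ratio hL2 h0 h1 hlim
  obtain ⟨k₀, hk₀⟩ := eventually_atTop.1 (hJ.eventually_const_lt
    (show (1 - θ) * s < s / 2 by nlinarith))
  have hθ0 : 0 < θ := by linarith
  have hdec : ∀ j, q (k₀ + j) ≤ θ ^ j := by
    intro j
    induction j with
    | zero => simpa using h1 k₀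
    | succ j ih =>
      have : q (k₀ + j + 1) ≤ q (k₀ + j) * θ := by
        rw [← mul_le_mul_iff_left₀ hpos, mul_assoc]
        refine (hstep _).2.trans (mul_le_mul_of_nonneg_left ?_ (h0 _))
        have := hk₀ (k₀ + j) (by omega)
        linarith
      rw [← add_assoc, pow_succ]
      exact this.trans (mul_le_mul_of_nonneg_right ih hθ0.le)
  refine ⟨(θ ^ k₀)⁻¹, by positivity, fun k => ?_⟩
  rcases le_total k₀ k with h | h
  · obtain ⟨j, rfl⟩ := Nat.exists_eq_add_of_le h
    rw [pow_add, ← mul_assoc, inv_mul_cancel₀ (by positivity), one_mul]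
    exact hdec j
  · refine (h1 k).trans ?_
    rw [inv_mul_eq_div, one_le_div (by positivity)]
    exact pow_le_pow_of_le_one hθ0.le hθ1.le h

theorem tsum_mul_eq_lintegral (μ : Measure ℕ) (f : ℕ → ℝ≥0∞) :
    ∑' i, μ {i} * f i = ∫⁻ i, f i ∂μ := by
  rw [lintegral_countable']
  exact tsum_congr fun i => mul_comm _ _

/-- The weight of the trees of large Horton-Strahler number decays almost like `2 ^ (-k)`. -/
theorem highWeight_le (hL2 : MemLp (fun k : ℕ => (k : ℝ)) 2 ν)
    (hmean : ∫ k : ℕ, (k : ℝ) ∂ν = 1) (hpos : 0 < factorialMoment ν)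
    (hw : ∑' t, treeWeight (fun i => ν {i}) t ≤ 1) {θ : ℝ} (hθ : 1 / 2 < θ) (hθ1 : θ < 1) :
    ∃ C : ℝ, 0 < C ∧ ∀ k, highWeight (fun i => ν {i}) k ≤ ENNReal.ofReal (C * θ ^ k) := by
  set p : ℕ → ℝ≥0∞ := fun i => ν {i} with hp
  have hle : ∀ k, lowWeight p k ≤ 1 := fun k =>
    le_trans (by rw [← lowWeight_add_highWeight p k]; exact le_self_add) hw
  have hfin : ∀ k, lowWeight p k ≠ ∞ := fun k => ((hle k).trans_lt ENNReal.one_lt_top).ne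
  have hlev : ∀ k, levelWeight p k ≠ ∞ := fun k => by
    have := hfin (k + 1)
    rw [lowWeight_succ] at this
    exact (ENNReal.add_ne_top.1 this).2
  have hsub : ∀ k, (levelWeight p k).toReal =
      (lowWeight p (k + 1)).toReal - (lowWeight p k).toReal := fun k => by
    rw [lowWeight_succ, ENNReal.toReal_add (hfin k) (hlev k)]; ring
  obtain ⟨C, hC, h⟩ := newton_decay (ν := ν) hL2 hmean hpos
    (q := fun k => 1 - (lowWeight p k).toReal)
    (fun k => by
      have := ENNReal.toReal_mono ENNReal.one_ne_top (hle k)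
      simpa using this)
    (fun k => by simp)
    (fun k => by
      have := ENNReal.toReal_nonneg (a := levelWeight p k)
      rw [hsub] at this
      linarith)
    (fun k => by
      have h1 := lowWeight_succ_eq_tsum p k
      rw [hp, tsum_mul_eq_lintegral, ← hp] at h1
      have h2 : ∀ i : ℕ, (1 - (1 - (lowWeight p k).toReal)) ^ i +
          i * (1 - (1 - (lowWeight p k).toReal)) ^ (i - 1) *
            (1 - (lowWeight p k).toReal - (1 - (lowWeight p (k + 1)).toReal)) =
          (lowWeight p k ^ i + i * lowWeight p k ^ (i - 1) * levelWeight p k).toReal := by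
        intro i
        rw [ENNReal.toReal_add (ENNReal.pow_ne_top (hfin k)) (by
          refine ENNReal.mul_ne_top (ENNReal.mul_ne_top (by simp) ?_) (hlev k)
          exact ENNReal.pow_ne_top (hfin k)), ENNReal.toReal_mul, ENNReal.toReal_mul, hsub]
        simp
      simp_rw [h2]
      rw [integral_toReal (by fun_prop) (ae_of_all _ fun i => ?_), ← h1]
      · ring
      · refine ENNReal.add_lt_top.2 ⟨ENNReal.pow_lt_top (hfin k).lt_top, ?_⟩
        refine ENNReal.mul_lt_top (ENNReal.mul_lt_top (by simp) ?_) (hlev k).lt_top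
        exact ENNReal.pow_lt_top (hfin k).lt_top)
    hθ hθ1
  refine ⟨C, hC, fun k => ?_⟩
  -- The iteration is run on `1 - lowWeight`, which dominates `highWeight` as soon as the finite
  -- trees have total weight at most `1`; almost sure finiteness is not needed.
  have h2 : highWeight p k ≤ 1 - lowWeight p k := by
    refine ENNReal.le_sub_of_add_le_left (hfin k) ?_
    rw [lowWeight_add_highWeight]
    exact hw
  refine h2.trans ?_
  rw [ENNReal.le_ofReal_iff_toReal_le (by simp) (by positivity), ENNReal.toReal_sub_of_le (hle k)
    (by simp)]
  simpa using h k

theorem exp_le_one_add_add_sq {x : ℝ} (hx : x ≤ 1) : Real.exp x ≤ 1 + x + x ^ 2 := by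
  rcases le_or_gt (-1) x with h | h
  · have := (abs_le.1 (Real.abs_exp_sub_one_sub_id_le (abs_le.2 ⟨h, hx⟩))).2
    linarith
  · have : Real.exp x ≤ 1 := Real.exp_le_one_iff.2 (by linarith)
    nlinarith

/-- The exponent `-c * (i - 1)` is at most `c ≤ 1`, so a quadratic bound applies for every `i`. The
linear term integrates to `0`, and for mean `1` the second moment of `i - 1` is the factorial
moment. -/
theorem laplace_le (hL2 : MemLp (fun k : ℕ => (k : ℝ)) 2 ν)
    (hmean : ∫ k : ℕ, (k : ℝ) ∂ν = 1) {c : ℝ} (h0 : 0 ≤ c) (h1 : c ≤ 1) :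
    ∑' i : ℕ, ν {i} * ENNReal.ofReal (Real.exp (-c * (i - 1))) ≤
      ENNReal.ofReal (Real.exp (c ^ 2 * factorialMoment ν)) := by
  rw [tsum_mul_eq_lintegral ν fun i : ℕ => ENNReal.ofReal (Real.exp (-c * (i - 1)))]
  have hI3 := integrable_nat hL2
  have hI4 := integrable_factorial hL2
  have hI5 : Integrable (fun i : ℕ => (1 + c + c ^ 2) + -(c + c ^ 2) * (i : ℝ)) ν :=
    (integrable_const _).add (hI3.const_mul _)
  have hI6 : Integrable (fun i : ℕ =>
      (1 + c + c ^ 2) + -(c + c ^ 2) * (i : ℝ) + c ^ 2 * (i * (i - 1) : ℝ)) ν :=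
    hI5.add (hI4.const_mul _)
  have hb : ∀ i : ℕ, Real.exp (-c * (i - 1)) ≤
      (1 + c + c ^ 2) + -(c + c ^ 2) * (i : ℝ) + c ^ 2 * (i * (i - 1) : ℝ) := by
    intro i
    refine (exp_le_one_add_add_sq ?_).trans (le_of_eq (by ring))
    have : (0 : ℝ) ≤ i := by positivity
    nlinarith
  calc ∫⁻ i : ℕ, ENNReal.ofReal (Real.exp (-c * (i - 1))) ∂ν
      ≤ ∫⁻ i : ℕ, ENNReal.ofReal
          ((1 + c + c ^ 2) + -(c + c ^ 2) * (i : ℝ) + c ^ 2 * (i * (i - 1) : ℝ)) ∂ν :=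
        lintegral_mono fun i => ENNReal.ofReal_le_ofReal (hb i)
    _ = ENNReal.ofReal (1 + c ^ 2 * factorialMoment ν) := by
        rw [← ofReal_integral_eq_lintegral_ofReal hI6
          (ae_of_all _ fun i => (Real.exp_nonneg _).trans (hb i)),
          integral_add hI5 (hI4.const_mul _),
          integral_add (integrable_const _) (hI3.const_mul _), integral_const_mul,
          integral_const_mul, hmean, ← factorialMoment]
        simp
    _ ≤ _ := ENNReal.ofReal_le_ofReal (by linarith [Real.add_one_le_exp (c ^ 2 * factorialMoment ν)])

end Newton
end

/-! ### Local limit estimates by characteristic functions -/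

section
open scoped ENNReal Real

variable (ν : Measure ℕ)

/-- The law of the sum of `n` independent variables of law `ν`. -/
noncomputable def sumLaw : ℕ → Measure ℕ
  | 0 => Measure.dirac 0
  | n + 1 => (ν.prod (sumLaw n)).map fun x => x.1 + x.2

theorem sumLaw_apply (n : ℕ) (s : Set ℕ) :
    sumLaw ν n s = wordExp (fun i => ν {i}) n fun y => s.indicator 1 y.sum := by
  induction n generalizing s with
  | zero => simp [sumLaw, wordExp]
  | succ n ih =>
    rw [sumLaw, Measure.map_apply (by fun_prop) MeasurableSet.of_discrete,
      Measure.prod_apply MeasurableSet.of_discrete, ← tsum_mul_eq_lintegral]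
    simp only [wordExp]
    refine tsum_congr fun i => ?_
    rw [ih]
    rfl

theorem sumLaw_singleton (n s : ℕ) : sumLaw ν n {s} = sumProb (fun i => ν {i}) n s := by
  rw [sumLaw_apply, sumProb]; simp [Set.indicator_apply]

/-- The characteristic function of a law on the natural numbers. -/
noncomputable def natCharFun (μ : Measure ℕ) (t : ℝ) : ℂ := ∫ k : ℕ, Complex.exp ((t * k : ℝ) * Complex.I) ∂μ

theorem natCharFun_sumLaw (n : ℕ) (t : ℝ) : natCharFun (sumLaw ν n) t = natCharFun ν t ^ n := by
  induction n with
  | zero => simp [natCharFun, sumLaw]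
  | succ n ih =>
    rw [natCharFun, sumLaw, integral_map (by fun_prop) (by fun_prop), pow_succ', ← ih,
      natCharFun, natCharFun, ← integral_prod_mul]
    refine integral_congr_ae (ae_of_all _ fun x => ?_)
    simp only
    rw [← Complex.exp_add]
    push_cast
    congr 1; ring

theorem ae_dvd_sumLaw {d : ℕ} (hd : ∀ k, ν {k} ≠ 0 → d ∣ k) (n : ℕ) :
    ∀ᵐ k ∂(sumLaw ν n), d ∣ k := by
  have hν : ∀ᵐ k ∂ν, d ∣ k := by
    rw [ae_iff_of_countable]
    exact hd
  induction n with
  | zero => rw [sumLaw, ae_dirac_eq]; simp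
  | succ n ih =>
    rw [sumLaw, ae_map_iff (by fun_prop) MeasurableSet.of_discrete]
    filter_upwards [Measure.quasiMeasurePreserving_fst.ae hν,
      Measure.quasiMeasurePreserving_snd.ae ih] with x h1 h2
    exact dvd_add h1 h2

theorem integrable_exp_mul_I {α : Type*} [MeasurableSpace α] (μ : Measure α) [IsFiniteMeasure μ]
    {f : α → ℝ} (hf : Measurable f) :
    Integrable (fun k => Complex.exp ((f k : ℝ) * Complex.I)) μ := by
  refine (integrable_const (1 : ℝ)).mono' (by fun_prop) (ae_of_all _ fun k => ?_)
  rw [Complex.norm_exp_ofReal_mul_I]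

variable [IsProbabilityMeasure ν]

instance isProbabilityMeasure_sumLaw (n : ℕ) : IsProbabilityMeasure (sumLaw ν n) := by
  induction n with
  | zero => rw [sumLaw]; infer_instance
  | succ n ih => rw [sumLaw]; exact Measure.isProbabilityMeasure_map (by fun_prop)

theorem norm_natCharFun_le_one (t : ℝ) : ‖natCharFun ν t‖ ≤ 1 := by
  refine (norm_integral_le_integral_norm _).trans ?_
  simp_rw [Complex.norm_exp_ofReal_mul_I]
  simp

theorem continuous_natCharFun : Continuous (natCharFun ν) := by
  refine continuous_of_dominated (bound := fun _ => 1) (fun t => by fun_prop)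
    (fun t => ae_of_all _ fun k => ?_) (integrable_const _) (ae_of_all _ fun k => by fun_prop)
  rw [Complex.norm_exp_ofReal_mul_I]

/-- This is the variance of a variable of modulus one. -/
theorem integral_norm_sub_natCharFun (t : ℝ) :
    ∫ k : ℕ, ‖Complex.exp ((t * k : ℝ) * Complex.I) - natCharFun ν t‖ ^ 2 ∂ν =
      1 - ‖natCharFun ν t‖ ^ 2 := by
  set φ := natCharFun ν t with hφ
  have hI := integrable_exp_mul_I ν (f := fun k : ℕ => t * k) (by fun_prop)
  have hI' : Integrable (fun k : ℕ => Complex.exp ((t * k : ℝ) * Complex.I) * star φ) ν :=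
    hI.mul_const _
  have hI2 : Integrable (fun k : ℕ => 2 * (Complex.exp ((t * k : ℝ) * Complex.I) * star φ).re) ν :=
    hI'.re.const_mul 2
  have h : ∀ k : ℕ, ‖Complex.exp ((t * k : ℝ) * Complex.I) - φ‖ ^ 2 =
      (1 + ‖φ‖ ^ 2) - 2 * (Complex.exp ((t * k : ℝ) * Complex.I) * star φ).re := by
    intro k
    have h1 := Complex.norm_exp_ofReal_mul_I (t * k)
    rw [← Complex.normSq_eq_norm_sq, Complex.normSq_sub, Complex.normSq_eq_norm_sq, h1,
      Complex.normSq_eq_norm_sq]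
    simp
  simp_rw [h]
  rw [integral_sub (integrable_const _) hI2, integral_const_mul]
  have h2 : ∫ k : ℕ, (Complex.exp ((t * k : ℝ) * Complex.I) * star φ).re ∂ν = ‖φ‖ ^ 2 := by
    have := integral_re hI'
    simp only [RCLike.re_to_complex] at this
    rw [this, integral_mul_const, ← natCharFun, ← hφ]
    have := Complex.mul_conj φ
    rw [Complex.normSq_eq_norm_sq] at this
    simp only [RCLike.star_def, this]
    exact Complex.ofReal_re _
  rw [h2]
  simp
  ring

/-- An atom of positive mass cannot lie far from the mean when the variance is small: keep only the
atom `k` in the variance integral. -/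
theorem norm_exp_sub_natCharFun_le {k : ℕ} (hk : ν {k} ≠ 0) :
    ∃ C : ℝ, 0 ≤ C ∧ ∀ t : ℝ, ‖Complex.exp ((t * k : ℝ) * Complex.I) - natCharFun ν t‖ ≤
      C * √(1 - ‖natCharFun ν t‖ ^ 2) := by
  have hpos : 0 < ν.real {k} := ENNReal.toReal_pos hk (measure_ne_top _ _)
  refine ⟨(√(ν.real {k}))⁻¹, by positivity, fun t => ?_⟩
  rw [← div_eq_inv_mul, ← Real.sqrt_div' _ hpos.le]
  apply Real.le_sqrt_of_sq_le
  rw [le_div_iff₀ hpos, ← integral_norm_sub_natCharFun, mul_comm, ← smul_eq_mul]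
  have := integral_singleton (μ := ν)
    (fun k : ℕ => ‖Complex.exp ((t * k : ℝ) * Complex.I) - natCharFun ν t‖ ^ 2) k
  rw [← this]
  refine setIntegral_le_integral ?_ (ae_of_all _ fun k => by positivity)
  refine (integrable_const (4 : ℝ)).mono' (by fun_prop) (ae_of_all _ fun k => ?_)
  rw [Real.norm_eq_abs, abs_of_nonneg (by positivity)]
  have h1 := norm_sub_le (Complex.exp ((t * k : ℝ) * Complex.I)) (natCharFun ν t)
  rw [Complex.norm_exp_ofReal_mul_I] at h1
  have h2 := norm_natCharFun_le_one ν t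
  have h3 := norm_nonneg (Complex.exp ((t * k : ℝ) * Complex.I) - natCharFun ν t)
  nlinarith

variable {ν}

/-- Without mass at `0`, mean `1` would force the value `1` almost surely. An atom at `0` makes the
span simply the gcd of the support. -/
theorem measure_singleton_zero_ne (hL2 : MemLp (fun k : ℕ => (k : ℝ)) 2 ν)
    (hmean : ∫ k : ℕ, (k : ℝ) ∂ν = 1) (hpos : 0 < factorialMoment ν) : ν {0} ≠ 0 := by
  intro h0
  have h1 : ∀ᵐ k : ℕ ∂ν, 0 ≤ (k : ℝ) - 1 := by
    rw [ae_iff]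
    refine measure_mono_null (fun k hk => ?_) h0
    simp only [sub_nonneg, Nat.one_le_cast, not_le, Nat.lt_one_iff, Set.mem_ofPred_eq] at hk
    exact hk
  have h2 : ∫ k : ℕ, ((k : ℝ) - 1) ∂ν = 0 := by
    rw [integral_sub (integrable_nat hL2) (integrable_const _), hmean]; simp
  rw [integral_eq_zero_iff_of_nonneg_ae h1 ((integrable_nat hL2).sub (integrable_const _))] at h2
  refine hpos.ne' (integral_eq_zero_of_ae ?_)
  filter_upwards [h2] with k hk
  simp only [Pi.zero_apply] at hk ⊢
  rw [hk, mul_zero]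

/-- The span of the support, and a Gaussian bound for the characteristic function. -/
theorem exists_span (hL2 : MemLp (fun k : ℕ => (k : ℝ)) 2 ν)
    (hmean : ∫ k : ℕ, (k : ℝ) ∂ν = 1) (hpos : 0 < factorialMoment ν) :
    ∃ d : ℕ, 0 < d ∧ (∀ k, ν {k} ≠ 0 → d ∣ k) ∧ ∃ c : ℝ, 0 < c ∧
      ∀ t : ℝ, |t| ≤ π / d → ‖natCharFun ν t‖ ≤ Real.exp (-c * t ^ 2) := by
  set S : Set ℤ := {x | ∃ k : ℕ, ν {k} ≠ 0 ∧ x = k} with hS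
  -- The integers `x` for which `exp (i t x)` is this close to `1` form a subgroup, and it contains
  -- the support because `0` is an atom. Hence the bound passes to the generator `d`.
  have hgood : ∀ x ∈ AddSubgroup.closure S, ∃ C : ℝ, 0 ≤ C ∧ ∀ t : ℝ,
      ‖Complex.exp ((t * x : ℝ) * Complex.I) - 1‖ ≤ C * √(1 - ‖natCharFun ν t‖ ^ 2) := by
    intro x hx
    induction hx using AddSubgroup.closure_induction with
    | mem x hx =>
      obtain ⟨k, hk, rfl⟩ := hx
      obtain ⟨C, hC0, hC⟩ := norm_exp_sub_natCharFun_le ν hk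
      obtain ⟨C', hC0', hC'⟩ := norm_exp_sub_natCharFun_le ν
        (measure_singleton_zero_ne hL2 hmean hpos)
      refine ⟨C + C', by positivity, fun t => ?_⟩
      have h1 := hC t
      have h2 := hC' t
      simp only [Nat.cast_zero, mul_zero, Complex.ofReal_zero, zero_mul, Complex.exp_zero] at h2
      rw [add_mul]
      refine (norm_sub_le_norm_sub_add_norm_sub _ (natCharFun ν t) _).trans ?_
      rw [norm_sub_rev (natCharFun ν t) 1]
      exact add_le_add (by exact_mod_cast h1) h2
    | zero => exact ⟨0, le_rfl, fun t => by simp⟩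
    | add x y _ _ hx hy =>
      obtain ⟨C, hC0, hC⟩ := hx
      obtain ⟨C', hC0', hC'⟩ := hy
      refine ⟨C + C', by positivity, fun t => ?_⟩
      have h : Complex.exp ((t * (x + y : ℤ) : ℝ) * Complex.I) - 1 =
          Complex.exp ((t * x : ℝ) * Complex.I) * (Complex.exp ((t * y : ℝ) * Complex.I) - 1) +
            (Complex.exp ((t * x : ℝ) * Complex.I) - 1) := by
        rw [mul_sub, ← Complex.exp_add]
        push_cast
        ring_nf
      rw [h, add_mul]
      refine (norm_add_le _ _).trans ?_
      rw [norm_mul, Complex.norm_exp_ofReal_mul_I, one_mul, add_comm]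
      exact add_le_add (hC t) (hC' t)
    | neg x _ hx =>
      obtain ⟨C, hC0, hC⟩ := hx
      refine ⟨C, hC0, fun t => ?_⟩
      have h : Complex.exp ((t * (-x : ℤ) : ℝ) * Complex.I) - 1 =
          -(Complex.exp ((t * (-x : ℤ) : ℝ) * Complex.I) *
            (Complex.exp ((t * x : ℝ) * Complex.I) - 1)) := by
        rw [mul_sub, ← Complex.exp_add]
        push_cast
        ring_nf
        rw [Complex.exp_zero]
        ring
      rw [h, norm_neg, norm_mul, Complex.norm_exp_ofReal_mul_I, one_mul]
      exact hC t
  obtain ⟨a, ha⟩ := Int.subgroup_cyclic (AddSubgroup.closure S)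
  have hdvd : ∀ k, ν {k} ≠ 0 → a.natAbs ∣ k := by
    intro k hk
    have hmem : (k : ℤ) ∈ AddSubgroup.closure S := AddSubgroup.subset_closure ⟨k, hk, rfl⟩
    rw [ha, AddSubgroup.mem_closure_singleton] at hmem
    obtain ⟨m, hm⟩ := hmem
    rw [← Int.natCast_dvd_natCast, Int.natCast_natAbs, abs_dvd]
    exact ⟨m, by rw [← hm, smul_eq_mul, mul_comm]⟩
  -- A zero generator would confine the law to `0`, contradicting positive mass on values at least
  -- `2`.
  have ha0 : 0 < a.natAbs := by
    rw [Nat.pos_iff_ne_zero]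
    intro h0
    rw [h0] at hdvd
    have := measureReal_two_le_pos hpos
    refine this.ne' ?_
    rw [measureReal_eq_zero_iff, ← Set.biUnion_of_singleton {i : ℕ | 2 ≤ i},
      measure_biUnion_null_iff (Set.to_countable _)]
    intro k hk
    by_contra hne
    have := Nat.eq_zero_of_zero_dvd (hdvd k hne)
    subst this
    simp at hk
  have hamem : (a.natAbs : ℤ) ∈ AddSubgroup.closure S := by
    have : a ∈ AddSubgroup.closure S := by rw [ha]; exact AddSubgroup.subset_closure rfl
    rcases Int.natAbs_eq a with h | h
    · rwa [← h]
    · rw [← neg_eq_iff_eq_neg.2 h]; exact neg_mem this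
  set d := a.natAbs
  have hd : (0 : ℝ) < d := by exact_mod_cast ha0
  obtain ⟨C, hC0, hC⟩ := hgood _ hamem
  refine ⟨d, ha0, hdvd, (2 / π * d / (C + 1)) ^ 2 / 2, by positivity, fun t ht => ?_⟩
  -- `|exp (i t d) - 1| = 2 |sin (t d / 2)|`, and Jordan's inequality bounds the sine from below
  -- exactly on the range `|t| ≤ π / d`.
  have h1 : 2 / π * (d * |t|) ≤ C * √(1 - ‖natCharFun ν t‖ ^ 2) := by
    refine le_trans ?_ (hC t)
    have h2 := Complex.norm_exp_I_mul_ofReal_sub_one (t * d)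
    rw [mul_comm] at h2
    push_cast at h2 ⊢
    rw [h2, norm_mul, Real.norm_eq_abs, Real.norm_eq_abs, abs_two]
    have h3 := Real.mul_abs_le_abs_sin (x := t * d / 2) (by
      rw [abs_div, abs_mul, abs_two, abs_of_pos hd]
      rw [le_div_iff₀ hd] at ht
      linarith)
    rw [abs_div, abs_mul, abs_two, abs_of_pos hd] at h3
    linarith
  have hnn : 0 ≤ 1 - ‖natCharFun ν t‖ ^ 2 := by
    have := norm_natCharFun_le_one ν t
    have := norm_nonneg (natCharFun ν t)
    nlinarith
  have h2 : (2 / π * d / (C + 1)) ^ 2 * t ^ 2 ≤ 1 - ‖natCharFun ν t‖ ^ 2 := by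
    have h3 : 2 / π * d / (C + 1) * |t| ≤ √(1 - ‖natCharFun ν t‖ ^ 2) := by
      rw [div_mul_eq_mul_div, div_le_iff₀ (by positivity)]
      have := Real.sqrt_nonneg (1 - ‖natCharFun ν t‖ ^ 2)
      linarith
    have h4 := pow_le_pow_left₀ (by positivity) h3 2
    rw [Real.sq_sqrt hnn, mul_pow, sq_abs] at h4
    exact h4
  refine le_of_sq_le_sq ?_ (Real.exp_nonneg _)
  rw [← Real.exp_nat_mul]
  refine le_trans (by linarith) (Real.one_sub_le_exp_neg ((2 / π * d / (C + 1)) ^ 2 * t ^ 2) |>.trans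
    (le_of_eq ?_))
  congr 1
  push_cast
  ring

theorem neg_pi_div_le (d : ℕ) : -(π / d) ≤ π / d := by
  have : 0 ≤ π / d := by positivity
  linarith

theorem integral_exp_int_mul {d : ℕ} (hd : 0 < d) (m : ℤ) (hm : (d : ℤ) ∣ m) :
    ∫ t in (-(π / d))..(π / d), Complex.exp ((t * m : ℝ) * Complex.I) =
      if m = 0 then ((2 * π / d : ℝ) : ℂ) else 0 := by
  have hd' : (d : ℂ) ≠ 0 := by exact_mod_cast hd.ne'
  split_ifs with h
  · subst h
    simp
    ring
  · obtain ⟨j, rfl⟩ := hm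
    have hc : (((d : ℤ) * j : ℤ) : ℂ) * Complex.I ≠ 0 :=
      mul_ne_zero (by exact_mod_cast h) Complex.I_ne_zero
    have h1 := integral_exp_mul_complex (a := -(π / d)) (b := π / d) hc
    have h2 : ∀ t : ℝ, Complex.exp ((t * ((d : ℤ) * j : ℤ) : ℝ) * Complex.I) =
        Complex.exp ((((d : ℤ) * j : ℤ) : ℂ) * Complex.I * t) := by
      intro t; push_cast; ring_nf
    simp_rw [h2]
    rw [h1, div_eq_zero_iff]
    left
    have h3 : (((d : ℤ) * j : ℤ) : ℂ) * Complex.I * ((π / d : ℝ) : ℂ) =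
        (((d : ℤ) * j : ℤ) : ℂ) * Complex.I * ((-(π / d) : ℝ) : ℂ) + j * (2 * π * Complex.I) := by
      push_cast
      field_simp
      ring
    rw [h3, Complex.exp_periodic.int_mul j, sub_self]

/-- Fourier inversion for lattice laws. -/
theorem fourier_inversion {d : ℕ} (hd : 0 < d) (hdvd : ∀ k, ν {k} ≠ 0 → d ∣ k) (n s : ℕ)
    (hs : d ∣ s) :
    ∫ t in (-(π / d))..(π / d), natCharFun ν t ^ n * Complex.exp (-(t * s : ℝ) * Complex.I) =
      ((2 * π / d * (sumLaw ν n).real {s} : ℝ) : ℂ) := by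
  have h1 : ∀ t : ℝ, natCharFun ν t ^ n * Complex.exp (-(t * s : ℝ) * Complex.I) =
      ∫ k : ℕ, Complex.exp ((t * ((k : ℤ) - s : ℤ) : ℝ) * Complex.I) ∂(sumLaw ν n) := by
    intro t
    rw [← natCharFun_sumLaw, natCharFun, ← integral_mul_const]
    refine integral_congr_ae (ae_of_all _ fun k => ?_)
    simp only
    rw [← Complex.exp_add]
    push_cast
    ring_nf
  simp_rw [h1]
  rw [intervalIntegral_integral_swap]
  -- All differences `k - s` are multiples of `d`, so a period of length `2π / d` already gives
  -- orthogonality.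
  · have h2 : ∀ᵐ k : ℕ ∂(sumLaw ν n), (∫ t in (-(π / d))..(π / d),
        Complex.exp ((t * ((k : ℤ) - s : ℤ) : ℝ) * Complex.I)) =
        ({s} : Set ℕ).indicator (fun _ => ((2 * π / d : ℝ) : ℂ)) k := by
      filter_upwards [ae_dvd_sumLaw ν hdvd n] with k hk
      rw [integral_exp_int_mul hd _ (dvd_sub (by exact_mod_cast hk) (by exact_mod_cast hs))]
      by_cases hks : k = s
      · simp [hks]
      · rw [if_neg (by omega)]
        simp [hks]
    rw [integral_congr_ae h2, integral_indicator_const _ (measurableSet_singleton s)]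
    rw [Complex.real_smul]
    push_cast
    ring
  · rw [Set.uIoc_of_le (neg_pi_div_le d)]
    exact integrable_exp_mul_I
      ((volume.restrict (Set.Ioc (-(π / d)) (π / d))).prod (sumLaw ν n))
      (f := fun x => x.1 * ((x.2 : ℤ) - s : ℤ)) (by fun_prop)

theorem norm_exp_neg_mul_I (x : ℝ) : ‖Complex.exp (-(x : ℂ) * Complex.I)‖ = 1 := by
  have := Complex.norm_exp_ofReal_mul_I (-x)
  rwa [Complex.ofReal_neg] at this

/-- The concentration function of the sum decays like the inverse square root. -/
theorem sumProb_le (hL2 : MemLp (fun k : ℕ => (k : ℝ)) 2 ν)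
    (hmean : ∫ k : ℕ, (k : ℝ) ∂ν = 1) (hpos : 0 < factorialMoment ν) :
    ∃ C : ℝ, 0 < C ∧ ∀ n : ℕ, 0 < n → ∀ s,
      sumProb (fun i => ν {i}) n s ≤ ENNReal.ofReal (C / √n) := by
  obtain ⟨d, hd, hdvd, c, hc, hφ⟩ := exists_span hL2 hmean hpos
  have hd' : (0 : ℝ) < d := by exact_mod_cast hd
  refine ⟨d / (2 * π) * √(π / c), by positivity, fun n hn s => ?_⟩
  rw [← sumLaw_singleton]
  by_cases hs : d ∣ s
  swap
  · have h0 : sumLaw ν n {s} = 0 := by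
      have := ae_dvd_sumLaw ν hdvd n
      rw [ae_iff] at this
      refine measure_mono_null (fun k hk => ?_) this
      rw [Set.mem_singleton_iff] at hk
      subst hk
      exact hs
    rw [h0]; exact zero_le
  rw [ENNReal.le_ofReal_iff_toReal_le (measure_ne_top _ _) (by positivity), ← measureReal_def]
  have h1 := congrArg norm (fourier_inversion hd hdvd n s hs)
  rw [Complex.norm_real, Real.norm_eq_abs, abs_of_nonneg (by positivity)] at h1
  have hn' : (0 : ℝ) < n := by exact_mod_cast hn
  have hint : Integrable fun t : ℝ => Real.exp (-(c * n) * t ^ 2) :=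
    integrable_exp_neg_mul_sq (by positivity)
  -- The integrand is at most `exp (-c n t ^ 2)` on the period; extending to the whole line gives a
  -- Gaussian integral of order `n ^ (-1/2)`.
  have h2 : 2 * π / d * (sumLaw ν n).real {s} ≤ √(π / (c * n)) := by
    rw [← h1, ← integral_gaussian, intervalIntegral.integral_of_le (neg_pi_div_le d)]
    refine (norm_integral_le_integral_norm _).trans ?_
    refine le_trans ?_ (setIntegral_le_integral (s := Set.Ioc (-(π / d)) (π / d)) hint (ae_of_all _ fun t => Real.exp_nonneg _))
    refine setIntegral_mono_on ?_ hint.integrableOn measurableSet_Ioc fun t ht => ?_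
    · have : Continuous fun t : ℝ => ‖natCharFun ν t ^ n * Complex.exp (-(t * s : ℝ) * Complex.I)‖ := by
        have := continuous_natCharFun ν
        fun_prop
      exact (this.integrableOn_Icc).mono_set Set.Ioc_subset_Icc_self
    · rw [norm_mul, norm_exp_neg_mul_I, mul_one, norm_pow]
      refine (pow_le_pow_left₀ (norm_nonneg _) (hφ t (abs_le.2 ⟨ht.1.le, ht.2⟩)) n).trans ?_
      rw [← Real.exp_nat_mul]
      exact le_of_eq (by ring_nf)
  rw [div_mul_comm] at h2
  have h3 : √(π / (c * n)) = √(π / c) / √n := by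
    rw [← div_div, Real.sqrt_div' _ hn'.le]
  rw [h3] at h2
  have h4 : (sumLaw ν n).real {s} ≤ d / (2 * π) * (√(π / c) / √n) := by
    rw [← div_le_iff₀' (by positivity)]
    refine le_trans (le_of_eq ?_) h2
    field_simp
  exact h4.trans (le_of_eq (by ring))

/-- The central limit theorem for `(k - 1) / s`. Centring at `n - 1` instead of `n` adds only the
phase `exp (i x / √n)`, which tends to `1`. -/
theorem tendsto_natCharFun_pow (hL2 : MemLp (fun k : ℕ => (k : ℝ)) 2 ν)
    (hmean : ∫ k : ℕ, (k : ℝ) ∂ν = 1) (hpos : 0 < factorialMoment ν) (x : ℝ) :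
    Tendsto (fun n : ℕ => natCharFun ν ((√n)⁻¹ * x) ^ n *
      Complex.exp (-((√n)⁻¹ * x * (n - 1 : ℕ) : ℝ) * Complex.I)) atTop
      (𝓝 (Real.exp (-(factorialMoment ν / 2) * x ^ 2))) := by
  set s := √(factorialMoment ν) with hs
  have hs0 : 0 < s := Real.sqrt_pos.2 hpos
  have hss : s ^ 2 = factorialMoment ν := Real.sq_sqrt hpos.le
  have hI3 := integrable_nat hL2
  have hI : Integrable (fun k : ℕ => (k : ℝ) - 1) ν := hI3.sub (integrable_const _)
  have h := tendsto_charFun_inv_sqrt_mul_pow (P := ν) (X := fun k : ℕ => ((k : ℝ) - 1) / s)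
    (by fun_prop) (by rw [integral_div, integral_sub hI3 (integrable_const _), hmean]; simp)
    (by
      have h1 : ∀ k : ℕ, ((fun k : ℕ => ((k : ℝ) - 1) / s) ^ 2) k =
          ((k * (k - 1) : ℝ) - (k - 1)) / factorialMoment ν := by
        intro k; rw [Pi.pow_apply, div_pow, hss]; ring
      simp_rw [h1]
      rw [integral_div, integral_sub (integrable_factorial hL2) hI, ← factorialMoment,
        integral_sub hI3 (integrable_const _), hmean]
      simp [hpos.ne']) (s * x)
  have hcf : ∀ u : ℝ, charFun (ν.map fun k : ℕ => ((k : ℝ) - 1) / s) (s * u) =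
      natCharFun ν u * Complex.exp (-(u : ℝ) * Complex.I) := by
    intro u
    rw [charFun_apply_real, integral_map (by fun_prop) (by fun_prop), natCharFun,
      ← integral_mul_const]
    refine integral_congr_ae (ae_of_all _ fun k => ?_)
    simp only
    rw [← Complex.exp_add]
    congr 1
    have : (s : ℂ) ≠ 0 := by exact_mod_cast hs0.ne'
    push_cast
    field_simp
    ring
  have h2 : Tendsto (fun n : ℕ => Complex.exp (((√n)⁻¹ * x : ℝ) * Complex.I)) atTop (𝓝 1) := by
    have h3 : Tendsto (fun n : ℕ => (√n)⁻¹ * x) atTop (𝓝 0) := by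
      rw [← zero_mul x]
      exact .mul_const x (tendsto_inv_atTop_zero.comp <| Real.tendsto_sqrt_atTop.comp <|
        tendsto_natCast_atTop_atTop)
    have h4 : Continuous fun y : ℝ => Complex.exp ((y : ℝ) * Complex.I) := by fun_prop
    have := (h4.tendsto 0).comp h3
    simpa [Function.comp_def] using this
  have h5 := h.mul h2
  rw [mul_one] at h5
  have hlim : Complex.exp (-((s * x : ℝ) : ℂ) ^ 2 / 2) =
      ((Real.exp (-(factorialMoment ν / 2) * x ^ 2) : ℝ) : ℂ) := by
    rw [← hss]; push_cast; ring_nf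
  rw [hlim] at h5
  refine h5.congr' ?_
  filter_upwards [eventually_ge_atTop 1] with n hn
  have : (√n)⁻¹ * (s * x) = s * ((√n)⁻¹ * x) := by ring
  rw [this, hcf, mul_pow, mul_assoc, ← Complex.exp_nat_mul, ← Complex.exp_add]
  push_cast [Nat.cast_sub hn]
  ring_nf

/-- The lower half of the local limit theorem at the mean. -/
theorem le_sumProb (hL2 : MemLp (fun k : ℕ => (k : ℝ)) 2 ν)
    (hmean : ∫ k : ℕ, (k : ℝ) ∂ν = 1) (hpos : 0 < factorialMoment ν) :
    ∃ c : ℝ, 0 < c ∧ ∀ᶠ n : ℕ in atTop, sumProb (fun i => ν {i}) n (n - 1) ≠ 0 →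
      ENNReal.ofReal (c / √n) ≤ sumProb (fun i => ν {i}) n (n - 1) := by
  obtain ⟨d, hd, hdvd, c, hc, hφ⟩ := exists_span hL2 hmean hpos
  have hd' : (0 : ℝ) < d := by exact_mod_cast hd
  -- The Fourier integrand cut off to one period. After the substitution `t = x / √n` it is
  -- dominated by `exp (-c x ^ 2)` uniformly in `n`, so the integrals converge.
  set g : ℕ → ℝ → ℂ := fun n t => (Set.Ioc (-(π / d)) (π / d)).indicator (fun t : ℝ =>
    natCharFun ν t ^ n * Complex.exp (-(t * (n - 1 : ℕ) : ℝ) * Complex.I)) t with hg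
  set L := √(π / (factorialMoment ν / 2)) with hL
  have hL0 : 0 < L := by positivity
  have hmeas : ∀ n, Measurable (g n) := by
    intro n
    refine Measurable.indicator ?_ measurableSet_Ioc
    have := continuous_natCharFun ν
    fun_prop
  have hlim : Tendsto (fun n : ℕ => ∫ x : ℝ, g n ((√n)⁻¹ * x)) atTop (𝓝 (L : ℂ)) := by
    have hLint : (L : ℂ) = ∫ x : ℝ, ((Real.exp (-(factorialMoment ν / 2) * x ^ 2) : ℝ) : ℂ) := by
      rw [integral_complex_ofReal, integral_gaussian]
    rw [hLint]
    refine tendsto_integral_filter_of_dominated_convergence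
      (fun x : ℝ => Real.exp (-c * x ^ 2)) (Eventually.of_forall fun n => ?_) ?_
      (integrable_exp_neg_mul_sq hc) (ae_of_all _ fun x => ?_)
    · exact ((hmeas n).comp (by fun_prop)).aestronglyMeasurable
    · filter_upwards [eventually_ge_atTop 1] with n hn
      refine ae_of_all _ fun x => ?_
      simp only [hg]
      rw [Set.indicator_apply]
      split_ifs with hx
      · rw [norm_mul, norm_exp_neg_mul_I, mul_one, norm_pow]
        refine (pow_le_pow_left₀ (norm_nonneg _) (hφ _ (abs_le.2 ⟨hx.1.le, hx.2⟩)) n).trans ?_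
        have hn' : (0 : ℝ) < n := by exact_mod_cast hn
        rw [← Real.exp_nat_mul, mul_pow, inv_pow, Real.sq_sqrt hn'.le]
        refine le_of_eq ?_
        congr 1
        field_simp
      · rw [norm_zero]; exact Real.exp_nonneg _
    · refine (tendsto_natCharFun_pow hL2 hmean hpos x).congr' ?_
      have h3 : Tendsto (fun n : ℕ => (√n)⁻¹ * x) atTop (𝓝 0) := by
        rw [← zero_mul x]
        exact .mul_const x (tendsto_inv_atTop_zero.comp <| Real.tendsto_sqrt_atTop.comp <|
          tendsto_natCast_atTop_atTop)
      have hpid : 0 < π / d := by positivity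
      filter_upwards [h3.eventually (Ioc_mem_nhds (neg_lt_zero.2 hpid) hpid)] with n hn
      simp only [hg]
      exact (Set.indicator_of_mem (s := Set.Ioc (-(π / d)) (π / d)) hn fun t : ℝ =>
        natCharFun ν t ^ n * Complex.exp (-(t * (n - 1 : ℕ) : ℝ) * Complex.I)).symm
  refine ⟨L / 2 * (d / (2 * π)), by positivity, ?_⟩
  have hnorm := (hlim.norm).eventually_const_lt (show L / 2 < ‖(L : ℂ)‖ by
    rw [Complex.norm_real, Real.norm_eq_abs, abs_of_pos hL0]; linarith)
  filter_upwards [hnorm, eventually_ge_atTop 1] with n hn hn1 hne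
  have hn' : (0 : ℝ) < n := by exact_mod_cast hn1
  -- This is where the hypothesis of nonzero probability enters: it puts `n - 1` on the lattice.
  have hdn : d ∣ n - 1 := by
    by_contra hcon
    apply hne
    rw [← sumLaw_singleton]
    have := ae_dvd_sumLaw ν hdvd n
    rw [ae_iff] at this
    refine measure_mono_null (fun k hk => ?_) this
    rw [Set.mem_singleton_iff] at hk
    subst hk
    exact hcon
  have h1 : ∫ x : ℝ, g n x = ((2 * π / d * (sumLaw ν n).real {n - 1} : ℝ) : ℂ) := by
    rw [← fourier_inversion hd hdvd n (n - 1) hdn, intervalIntegral.integral_of_le (neg_pi_div_le d),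
      ← integral_indicator measurableSet_Ioc]
  rw [Measure.integral_comp_inv_mul_left, h1, norm_smul, Complex.norm_real, Real.norm_eq_abs,
    Real.norm_eq_abs, abs_abs, abs_of_nonneg (Real.sqrt_nonneg _), abs_of_nonneg (by positivity)]
    at hn
  rw [← sumLaw_singleton, ENNReal.ofReal_le_iff_le_toReal (measure_ne_top _ _), ← measureReal_def]
  have hsq : 0 < √(n : ℝ) := Real.sqrt_pos.2 hn'
  rw [div_le_iff₀ hsq]
  have h2 : L / 2 * (d / (2 * π)) ≤
      √(n : ℝ) * (2 * π / d * (sumLaw ν n).real {n - 1}) * (d / (2 * π)) :=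
    mul_le_mul_of_nonneg_right hn.le (by positivity)
  refine h2.trans (le_of_eq ?_)
  field_simp

end

/-! ### The law of the Galton–Watson tree -/

section
open scoped ENNReal Classical
open PlaneTree

theorem isFamilyTree_node_iff (d : List ℕ → ℕ) (ts : List PlaneTree) :
    IsFamilyTree d (node ts) ↔ d [] = ts.length ∧
      ∀ i : Fin ts.length, IsFamilyTree (fun u => d ((i : ℕ) :: u)) (ts.get i) := by
  constructor
  · rintro ⟨_, _, h1, h2⟩
    exact ⟨h1, h2⟩
  · rintro ⟨h1, h2⟩
    exact .node d ts h1 h2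

/-- The offset `j` allows induction on the list of trees; recording that all addresses begin with an
index at least `j` keeps those of different trees distinct. -/
theorem exists_addresses_forest (ts : List PlaneTree)
    (h : ∀ t ∈ ts, ∃ L : List (List ℕ × ℕ), (L.map Prod.fst).Nodup ∧ L.map Prod.snd = t.code ∧
      ∀ d, IsFamilyTree d t ↔ ∀ x ∈ L, d x.1 = x.2) (j : ℕ) :
    ∃ L : List (List ℕ × ℕ), (L.map Prod.fst).Nodup ∧ L.map Prod.snd = forestCode ts ∧
      (∀ x ∈ L, ∃ i u, x.1 = i :: u ∧ j ≤ i) ∧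
      ∀ d : List ℕ → ℕ, (∀ i : Fin ts.length, IsFamilyTree (fun u => d ((j + i : ℕ) :: u)) (ts.get i)) ↔
        ∀ x ∈ L, d x.1 = x.2 := by
  induction ts generalizing j with
  | nil => exact ⟨[], by simp⟩
  | cons t ts ih =>
    obtain ⟨L, h1, h2, h3⟩ := h t (by simp)
    obtain ⟨L', h1', h2', h3', h4'⟩ := ih (fun s hs => h s (by simp [hs])) (j + 1)
    refine ⟨L.map (fun x => (j :: x.1, x.2)) ++ L', ?_, ?_, ?_, ?_⟩
    · rw [List.map_append, List.map_map, List.nodup_append]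
      refine ⟨?_, h1', ?_⟩
      · have : (Prod.fst ∘ fun x : List ℕ × ℕ => (j :: x.1, x.2)) = List.cons j ∘ Prod.fst := rfl
        rw [this, ← List.map_map]
        exact h1.map List.cons_injective
      · rintro a ha b hb rfl
        obtain ⟨x, -, rfl⟩ := List.mem_map.1 ha
        obtain ⟨y, hy, hxy⟩ := List.mem_map.1 hb
        obtain ⟨i, u, hi, hij⟩ := h3' y hy
        rw [hi] at hxy
        simp at hxy
        omega
    · rw [List.map_append, h2', List.map_map, forestCode_cons, ← h2]
      rfl
    · intro x hx
      rcases List.mem_append.1 hx with hx | hx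
      · obtain ⟨y, -, rfl⟩ := List.mem_map.1 hx
        exact ⟨j, y.1, rfl, le_rfl⟩
      · obtain ⟨i, u, hi, hij⟩ := h3' x hx
        exact ⟨i, u, hi, by omega⟩
    · intro d
      have hsucc : ∀ i : ℕ, j + (i + 1) = j + 1 + i := fun i => by omega
      have hfin : (∀ i : Fin (t :: ts).length,
          IsFamilyTree (fun u => d ((j + i : ℕ) :: u)) ((t :: ts).get i)) ↔
          IsFamilyTree (fun u => d (j :: u)) t ∧ ∀ i : Fin ts.length,
            IsFamilyTree (fun u => d ((j + 1 + i : ℕ) :: u)) (ts.get i) := by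
        refine (Fin.forall_fin_succ (n := ts.length)).trans (and_congr ?_ ?_)
        · simp
        · refine forall_congr' fun i => ?_
          rw [List.get_cons_succ', Fin.val_succ, hsucc]
      rw [hfin, h4', h3]
      simp only [List.mem_append, List.mem_map, or_imp, forall_and, forall_exists_index, and_imp,
        forall_apply_eq_imp_iff₂]

/-- A finite tree is described by the numbers of children at finitely many addresses. -/
theorem exists_addresses (t : PlaneTree) :
    ∃ L : List (List ℕ × ℕ), (L.map Prod.fst).Nodup ∧ L.map Prod.snd = t.code ∧
      ∀ d, IsFamilyTree d t ↔ ∀ x ∈ L, d x.1 = x.2 := by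
  induction t using nodeInduction with
  | h ts ih =>
    obtain ⟨L, h1, h2, h3, h4⟩ := exists_addresses_forest ts ih 0
    refine ⟨([], ts.length) :: L, ?_, ?_, ?_⟩
    · rw [List.map_cons, List.nodup_cons]
      refine ⟨fun hmem => ?_, h1⟩
      obtain ⟨x, hx, hx'⟩ := List.mem_map.1 hmem
      obtain ⟨i, u, hi, -⟩ := h3 x hx
      rw [hi] at hx'
      simp at hx'
    · rw [List.map_cons, h2, code_node]
    · intro d
      rw [isFamilyTree_node_iff, List.forall_mem_cons, ← h4]
      simp

instance : Countable PlaneTree := code_injective.countable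

theorem galtonWatsonTree_event_eq {Ω : Type*} (ξ : List ℕ → Ω → ℕ) (Q : PlaneTree → Prop)
    [DecidablePred Q] :
    {ω | ∃ t, galtonWatsonTree ξ ω = some t ∧ Q t} =
      ⋃ t, if Q t then {ω | galtonWatsonTree ξ ω = some t} else ∅ := by
  ext ω
  rw [Set.mem_iUnion]
  refine exists_congr fun t => ?_
  by_cases h : Q t <;> simp [h]

section Law

variable {Ω : Type*} [MeasurableSpace Ω] {P : Measure Ω} {ν : Measure ℕ} {ξ : List ℕ → Ω → ℕ}

theorem measurableSet_galtonWatsonTree_eq (hξ : IsOffspringFamily P ν ξ) (t : PlaneTree) :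
    MeasurableSet {ω | galtonWatsonTree ξ ω = some t} := by
  obtain ⟨L, -, -, h⟩ := exists_addresses t
  have : {ω | galtonWatsonTree ξ ω = some t} = ⋂ x ∈ L, ξ x.1 ⁻¹' {x.2} := by
    ext ω
    simp [galtonWatsonTree, familyTree_eq_some_iff, h]
  rw [this]
  exact MeasurableSet.biInter (Set.to_countable _) fun x _ =>
    hξ.measurable _ (measurableSet_singleton _)

theorem measure_galtonWatsonTree_eq (hξ : IsOffspringFamily P ν ξ) (t : PlaneTree) :
    P {ω | galtonWatsonTree ξ ω = some t} = treeWeight (fun i => ν {i}) t := by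
  obtain ⟨L, h1, h2, h⟩ := exists_addresses t
  have hset : {ω | galtonWatsonTree ξ ω = some t} =
      ⋂ i ∈ (Finset.univ : Finset (Fin L.length)), (ξ (L.get i).1) ⁻¹' {(L.get i).2} := by
    ext ω
    simp only [galtonWatsonTree, familyTree_eq_some_iff, h, Finset.mem_univ, Set.iInter_true]
    simp [List.forall_mem_iff_get]
  have hinj : Function.Injective fun i : Fin L.length => (L.get i).1 := by
    intro i j hij
    have := List.nodup_iff_injective_get.1 h1 (a₁ := i.cast (by simp)) (a₂ := j.cast (by simp))
      (by simpa using hij)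
    simpa [Fin.ext_iff] using this
  rw [hset, (hξ.indep.precomp hinj).measure_inter_preimage_eq_mul Finset.univ
    fun i _ => measurableSet_singleton _]
  have hν : ∀ i : Fin L.length, P (ξ (L.get i).1 ⁻¹' {(L.get i).2}) = ν {(L.get i).2} := by
    intro i
    rw [← Measure.map_apply (hξ.measurable _) (measurableSet_singleton _), hξ.map_eq]
  simp_rw [hν]
  rw [treeWeight, wordWeight, ← h2, List.map_map, ← List.prod_ofFn]
  congr 1
  refine List.ext_get (by simp) fun i _ _ => by simp

theorem measurableSet_galtonWatsonTree_event (hξ : IsOffspringFamily P ν ξ)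
    (Q : PlaneTree → Prop) : MeasurableSet {ω | ∃ t, galtonWatsonTree ξ ω = some t ∧ Q t} := by
  rw [galtonWatsonTree_event_eq]
  refine MeasurableSet.iUnion fun t => ?_
  split_ifs
  · exact measurableSet_galtonWatsonTree_eq hξ t
  · exact .empty

theorem measure_galtonWatsonTree_event (hξ : IsOffspringFamily P ν ξ) (Q : PlaneTree → Prop)
    [DecidablePred Q] :
    P {ω | ∃ t, galtonWatsonTree ξ ω = some t ∧ Q t} =
      ∑' t, if Q t then treeWeight (fun i => ν {i}) t else 0 := by
  rw [galtonWatsonTree_event_eq, measure_iUnion]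
  · refine tsum_congr fun t => ?_
    split_ifs
    · exact measure_galtonWatsonTree_eq hξ t
    · simp
  · intro s t hst
    rw [Function.onFun, Set.disjoint_left]
    intro ω h1 h2
    split_ifs at h1 h2 <;> first | exact h1 | exact h2 | skip
    simp only [Set.mem_ofPred_eq] at h1 h2
    exact hst (Option.some.inj (h1.symm.trans h2))
  · intro t
    split_ifs
    · exact measurableSet_galtonWatsonTree_eq hξ t
    · exact .empty

theorem tsum_treeWeight_le_one [IsProbabilityMeasure P] (hξ : IsOffspringFamily P ν ξ) :
    ∑' t, treeWeight (fun i => ν {i}) t ≤ 1 := by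
  have := measure_galtonWatsonTree_event hξ fun _ => True
  simp only [if_true] at this
  rw [← this]
  exact prob_le_one

end Law

/-! ### Bounds with explicit dependence on the size -/

section Bounds

variable {ν : Measure ℕ} [IsProbabilityMeasure ν]

/-- Chernoff's parameter is taken as `1 / √n`, so that the Laplace factor raised to a power `j ≤ n`
stays below `exp s`; the sum over `j` costs at most `2 * n`. -/
theorem wordExp_hasHighTree_le_ofReal (hL2 : MemLp (fun k : ℕ => (k : ℝ)) 2 ν)
    (hmean : ∫ k : ℕ, (k : ℝ) ∂ν = 1) (hpos : 0 < factorialMoment ν)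
    (hw : ∑' t, treeWeight (fun i => ν {i}) t ≤ 1) {θ : ℝ} (hθ : 1 / 2 < θ) (hθ1 : θ < 1) :
    ∃ C : ℝ, 0 < C ∧ ∀ n M k R : ℕ, 0 < n → M ≤ n →
      (wordExp (fun i => ν {i}) M fun y => if HasHighTree k y then 1 else 0) ≤
        ENNReal.ofReal (C * (R * θ ^ k + n * Real.exp (-(R / √n)))) := by
  obtain ⟨C, hC, hhigh⟩ := highWeight_le hL2 hmean hpos hw hθ hθ1
  have hθ0 : 0 < θ := by linarith
  set s := factorialMoment ν
  refine ⟨C + 2 * Real.exp s, by positivity, fun n M k R hn hM => ?_⟩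
  have hn' : (1 : ℝ) ≤ n := by exact_mod_cast hn
  have hp : ∑' i, ν {i} = 1 := by
    have := tsum_mul_eq_lintegral ν fun _ => 1
    simpa using this
  refine (wordExp_hasHighTree_le _ hp hw M k R).trans ?_
  have h1 : (R : ℝ≥0∞) * highWeight (fun i => ν {i}) k ≤ ENNReal.ofReal (R * (C * θ ^ k)) := by
    rw [ENNReal.ofReal_mul (by positivity), ENNReal.ofReal_natCast]
    gcongr
    exact hhigh k
  have hc0 : 0 ≤ (√(n : ℝ))⁻¹ := by positivity
  have hc1 : (√(n : ℝ))⁻¹ ≤ 1 := inv_le_one_of_one_le₀ (Real.one_le_sqrt.2 hn')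
  have h2 : ∀ j ∈ Finset.range (M + 1), (wordExp (fun i => ν {i}) j fun y =>
      if height y ≤ -R then 1 else 0) ≤
      ENNReal.ofReal (Real.exp (-(R / √n)) * Real.exp s) := by
    intro j hj
    refine (wordExp_height_le _ j R hc0).trans ?_
    rw [ENNReal.ofReal_mul (Real.exp_nonneg _)]
    have e1 : -(√(n : ℝ))⁻¹ * R = -(R / √n) := by rw [div_eq_inv_mul]; ring
    rw [e1]
    gcongr
    refine (pow_le_pow_left' (laplace_le hL2 hmean hc0 hc1) j).trans ?_
    rw [← ENNReal.ofReal_pow (Real.exp_nonneg _), ← Real.exp_nat_mul]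
    refine ENNReal.ofReal_le_ofReal (Real.exp_le_exp.2 ?_)
    rw [inv_pow, Real.sq_sqrt (by positivity), ← mul_assoc]
    refine mul_le_of_le_one_left hpos.le ?_
    rw [← div_eq_mul_inv, div_le_one (by positivity)]
    have : j ≤ n := by have := Finset.mem_range.1 hj; omega
    exact_mod_cast this
  refine (add_le_add h1 (Finset.sum_le_sum h2)).trans ?_
  rw [Finset.sum_const, Finset.card_range, nsmul_eq_mul, ← ENNReal.ofReal_natCast (M + 1),
    ← ENNReal.ofReal_mul (by positivity), ← ENNReal.ofReal_add (by positivity) (by positivity)]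
  refine ENNReal.ofReal_le_ofReal ?_
  have hM' : ((M + 1 : ℕ) : ℝ) ≤ 2 * n := by
    push_cast
    have : (M : ℝ) ≤ n := by exact_mod_cast hM
    linarith
  have h3 := mul_le_mul_of_nonneg_right hM'
    (show 0 ≤ Real.exp (-(R / √n)) * Real.exp s by positivity)
  have h4 : 0 ≤ C * (n * Real.exp (-(R / √n))) := by positivity
  have h5 : 0 ≤ 2 * Real.exp s * (R * θ ^ k) := by positivity
  nlinarith

/-- The ratio of the local probabilities in the cycle lemma estimate is bounded. -/
theorem exists_iSup_sumProb_le (hL2 : MemLp (fun k : ℕ => (k : ℝ)) 2 ν)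
    (hmean : ∫ k : ℕ, (k : ℝ) ∂ν = 1) (hpos : 0 < factorialMoment ν) :
    ∃ C : ℝ, 0 < C ∧ ∀ᶠ n : ℕ in atTop, sumProb (fun i => ν {i}) n (n - 1) ≠ 0 →
      ⨆ s, sumProb (fun i => ν {i}) (n / 4) s ≤
        ENNReal.ofReal C * sumProb (fun i => ν {i}) n (n - 1) := by
  obtain ⟨A, hA, hup⟩ := sumProb_le hL2 hmean hpos
  obtain ⟨c, hc, hlow⟩ := le_sumProb hL2 hmean hpos
  refine ⟨A * √8 / c, by positivity, ?_⟩
  filter_upwards [hlow, eventually_ge_atTop 8] with n hn hn8 hne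
  refine le_trans ?_ (mul_le_mul_right (hn hne) _)
  rw [← ENNReal.ofReal_mul (by positivity)]
  refine iSup_le fun s => (hup (n / 4) (by omega) s).trans (ENNReal.ofReal_le_ofReal ?_)
  have hn0 : (0 : ℝ) < n := by exact_mod_cast (by omega : 0 < n)
  -- Integer division still gives `n ≤ 8 * (n / 4)` here, which is the source of `√8`.
  have h1 : √(n : ℝ) ≤ √8 * √((n / 4 : ℕ) : ℝ) := by
    rw [← Real.sqrt_mul (by norm_num)]
    refine Real.sqrt_le_sqrt ?_
    exact_mod_cast (by omega : n ≤ 8 * (n / 4))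
  have h2 : 0 < √((n / 4 : ℕ) : ℝ) :=
    Real.sqrt_pos.2 (by exact_mod_cast (by omega : 0 < n / 4))
  have h3 : 0 < √(n : ℝ) := Real.sqrt_pos.2 hn0
  have h4 : A * √8 / c * (c / √n) = A * √8 / √n := by field_simp
  rw [h4, div_le_div_iff₀ h2 h3, mul_assoc]
  exact mul_le_mul_of_nonneg_left h1 hA.le

end Bounds

theorem tendsto_natCast_mul_exp_neg_rpow {δ : ℝ} (hδ : 0 < δ) :
    Tendsto (fun n : ℕ => (n : ℝ) * Real.exp (-(n : ℝ) ^ δ)) atTop (𝓝 0) := by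
  have h1 := (tendsto_rpow_mul_exp_neg_mul_atTop_nhds_zero (1 / δ) 1 one_pos).comp
    ((tendsto_rpow_atTop hδ).comp tendsto_natCast_atTop_atTop)
  refine h1.congr fun n => ?_
  simp only [Function.comp_apply]
  rw [← Real.rpow_mul (by positivity), mul_one_div_cancel hδ.ne', Real.rpow_one, neg_one_mul]

end

/-! ### Choice of the exponents and conclusion -/

theorem corollary1 {Ω : Type*} [MeasurableSpace Ω] (P : Measure Ω) [IsProbabilityMeasure P]
    (ν : Measure ℕ) [IsProbabilityMeasure ν]
    (hL2 : MemLp (fun k : ℕ => (k : ℝ)) 2 ν)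
    (hmean : ∫ k : ℕ, (k : ℝ) ∂ν = 1)
    (hvar : 0 < variance (fun k : ℕ => (k : ℝ)) ν)
    (ξ : List ℕ → Ω → ℕ) (hξ : IsOffspringFamily P ν ξ)
    (ε : ℝ) (hε : 0 < ε) :
    Tendsto
      (fun n : ℕ =>
        P[hortonStrahlerEvent ξ ((1 / 2 + ε) * Real.logb 2 (n : ℝ)) | sizeEvent ξ n])
      (atTop ⊓ 𝓟 {n : ℕ | P (sizeEvent ξ n) ≠ 0}) (𝓝 0) := by
  classical
  have hpos : 0 < factorialMoment ν := by rwa [← variance_eq_factorialMoment hL2 hmean]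
  have hw := tsum_treeWeight_le_one hξ
  set p : ℕ → ENNReal := fun i => ν {i} with hp
  -- Chosen so that `θ ^ x = n ^ (-(1/2 + 3ε/4))` at the threshold `x`; since `η < 1`, the base `θ`
  -- is still above `1/2`.
  set η : ℝ := (1 / 2 + 3 * ε / 4) / (1 / 2 + ε) with hη
  have hη1 : η < 1 := by rw [hη, div_lt_one (by positivity)]; linarith
  have hη0 : 0 < η := by positivity
  set θ : ℝ := 2 ^ (-η) with hθdef
  have hθ : 1 / 2 < θ := by
    rw [hθdef, show (1 / 2 : ℝ) = 2 ^ (-1 : ℝ) by rw [Real.rpow_neg_one]; norm_num]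
    exact Real.rpow_lt_rpow_of_exponent_lt (by norm_num) (by linarith)
  have hθ1 : θ < 1 := Real.rpow_lt_one_of_one_lt_of_neg (by norm_num) (by linarith)
  have hθ0 : 0 < θ := by positivity
  obtain ⟨C, hC, hbad⟩ := wordExp_hasHighTree_le_ofReal hL2 hmean hpos hw hθ hθ1
  obtain ⟨D, hD, hratio⟩ := exists_iSup_sumProb_le hL2 hmean hpos
  set b : ℕ → ℝ := fun n => 4 * D * C * (2 * θ⁻¹ * (n : ℝ) ^ (-(ε / 4)) +
    n * Real.exp (-(n : ℝ) ^ (ε / 2))) with hb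
  have hblim : Tendsto b atTop (𝓝 0) := by
    have h1 : Tendsto (fun n : ℕ => (n : ℝ) ^ (-(ε / 4))) atTop (𝓝 0) :=
      (tendsto_rpow_neg_atTop (by positivity)).comp tendsto_natCast_atTop_atTop
    have h2 := ((h1.const_mul (2 * θ⁻¹)).add
      (tendsto_natCast_mul_exp_neg_rpow (half_pos hε))).const_mul (4 * D * C)
    simpa [hb] using h2
  have hblim' : Tendsto (fun n => ENNReal.ofReal (b n)) atTop (𝓝 0) := by
    simpa using ENNReal.tendsto_ofReal hblim
  refine tendsto_of_tendsto_of_tendsto_of_le_of_le' tendsto_const_nhds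
    (hblim'.mono_left inf_le_left) (Eventually.of_forall fun _ => zero_le) ?_
  rw [eventually_inf_principal]
  filter_upwards [hratio, eventually_ge_atTop 2] with n hn hn2 hne
  have hn0 : (0 : ℝ) < n := by exact_mod_cast (by omega : 0 < n)
  have hn1 : (1 : ℝ) ≤ n := by exact_mod_cast (by omega : 1 ≤ n)
  set x : ℝ := (1 / 2 + ε) * Real.logb 2 n with hx
  have hx0 : 0 < x := mul_pos (by positivity)
    (Real.logb_pos (by norm_num) (by exact_mod_cast (by omega : 1 < n)))
  -- A number at least `x` is at least `K + 1`, and passing to a subtree off the path loses one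
  -- level. The rounding `K ≥ x - 1` costs a factor `θ⁻¹`.
  obtain ⟨K, hK⟩ : ∃ K, ⌈x⌉₊ = K + 1 := ⟨⌈x⌉₊ - 1, by have := Nat.ceil_pos.2 hx0; omega⟩
  have hKx : x - 1 ≤ K := by
    have := Nat.le_ceil x
    rw [hK] at this
    push_cast at this
    linarith
  -- Larger than `√n` by the factor `n ^ (ε/2)`, which kills the Chernoff term, yet small enough
  -- that `R * θ ^ K` is of order at most `n ^ (-(ε/4))`.
  set R : ℕ := ⌈(n : ℝ) ^ (1 / 2 + ε / 2)⌉₊ with hR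
  have hsize : P (sizeEvent ξ n) = ∑' t : PlaneTree, if t.size = n then treeWeight p t else 0 :=
    measure_galtonWatsonTree_event hξ fun t => t.size = n
  have hcycle := sumProb_eq_mul_tsum p n (by omega)
  rw [← hsize] at hcycle
  have hinter : P (sizeEvent ξ n ∩ hortonStrahlerEvent ξ x) ≤
      ∑' t : PlaneTree, if t.size = n ∧ K + 1 ≤ t.hortonStrahler then treeWeight p t else 0 := by
    have h1 := measure_galtonWatsonTree_event hξ fun t => t.size = n ∧ K + 1 ≤ t.hortonStrahler
    refine le_trans (measure_mono ?_) h1.le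
    rintro ω ⟨⟨t, ht, htn⟩, s, hs, hxs⟩
    obtain rfl : t = s := Option.some.inj (ht.symm.trans hs)
    exact ⟨t, ht, htn, by rw [← hK]; exact Nat.ceil_le.2 hxs⟩
  have hmain := size_mul_tsum_high_le p n K (by omega)
  have hbadn := hbad n (n - n / 4) K R (by omega) (Nat.sub_le _ _)
  have hn' : (n : ENNReal) ≠ 0 := by simp; omega
  have hs0 : sumProb p n (n - 1) ≠ 0 := by
    rw [hcycle]
    exact mul_ne_zero hn' hne
  have hreal : C * (R * θ ^ K + n * Real.exp (-(R / √n))) * (4 * D) ≤ b n := by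
    have h1 : (R : ℝ) ≤ 2 * (n : ℝ) ^ (1 / 2 + ε / 2) := by
      have := (Nat.ceil_lt_add_one (show 0 ≤ (n : ℝ) ^ (1 / 2 + ε / 2) by positivity)).le
      have := Real.one_le_rpow hn1 (show 0 ≤ 1 / 2 + ε / 2 by positivity)
      linarith
    have h2 : θ ^ K ≤ θ⁻¹ * (n : ℝ) ^ (-(1 / 2 + 3 * ε / 4)) := by
      calc θ ^ K = θ ^ (K : ℝ) := (Real.rpow_natCast _ _).symm
        _ ≤ θ ^ (x - 1) := Real.rpow_le_rpow_of_exponent_ge hθ0 hθ1.le hKx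
        _ = θ⁻¹ * θ ^ x := by rw [Real.rpow_sub_one hθ0.ne', div_eq_inv_mul]
        _ = _ := by
          congr 1
          have h3 : (n : ℝ) = 2 ^ Real.logb 2 n :=
            (Real.rpow_logb (by norm_num) (by norm_num) hn0).symm
          have h4 : -η * x = Real.logb 2 n * -(1 / 2 + 3 * ε / 4) := by
            rw [hx, hη]; field_simp
          rw [hθdef, ← Real.rpow_mul (by norm_num), h4, Real.rpow_mul (by norm_num), ← h3]
    have h3 : (n : ℝ) ^ (ε / 2) ≤ R / √n := by
      rw [le_div_iff₀ (Real.sqrt_pos.2 hn0), Real.sqrt_eq_rpow, ← Real.rpow_add hn0, add_comm]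
      exact Nat.le_ceil _
    have h4 : (R : ℝ) * θ ^ K ≤ 2 * θ⁻¹ * (n : ℝ) ^ (-(ε / 4)) := by
      refine (mul_le_mul h1 h2 (by positivity) (by positivity)).trans (le_of_eq ?_)
      have : (n : ℝ) ^ (-(ε / 4)) =
          (n : ℝ) ^ (1 / 2 + ε / 2) * (n : ℝ) ^ (-(1 / 2 + 3 * ε / 4)) := by
        rw [← Real.rpow_add hn0]; ring_nf
      rw [this]; ring
    have h5 : (n : ℝ) * Real.exp (-(R / √n)) ≤ n * Real.exp (-(n : ℝ) ^ (ε / 2)) := by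
      gcongr
    calc C * (R * θ ^ K + n * Real.exp (-(R / √n))) * (4 * D)
        = 4 * D * C * (R * θ ^ K + n * Real.exp (-(R / √n))) := by ring
      _ ≤ b n := mul_le_mul_of_nonneg_left (add_le_add h4 h5) (by positivity)
  have hmeas : MeasurableSet (sizeEvent ξ n) :=
    measurableSet_galtonWatsonTree_event hξ fun t => t.size = n
  rw [cond_apply hmeas]
  change (P (sizeEvent ξ n))⁻¹ * P (sizeEvent ξ n ∩ hortonStrahlerEvent ξ x) ≤ _
  rw [mul_comm, ← div_eq_mul_inv]
  refine ENNReal.div_le_of_le_mul ?_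
  -- The factor `n` brings in the marked node on the left and, by the cycle lemma, `sumProb p n (n -
  -- 1)` on the right.
  rw [← ENNReal.mul_le_mul_iff_right hn' (ENNReal.natCast_ne_top n)]
  calc (n : ENNReal) * P (sizeEvent ξ n ∩ hortonStrahlerEvent ξ x)
      ≤ 4 * (wordExp p (n - n / 4) fun y => if HasHighTree K y then 1 else 0) *
        ⨆ s, sumProb p (n / 4) s := (mul_le_mul_right hinter _).trans hmain
    _ ≤ 4 * ENNReal.ofReal (C * (R * θ ^ K + n * Real.exp (-(R / √n)))) *
        (ENNReal.ofReal D * sumProb p n (n - 1)) := by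
      gcongr
      exact hn hs0
    _ = ENNReal.ofReal (C * (R * θ ^ K + n * Real.exp (-(R / √n))) * (4 * D)) *
        (n * P (sizeEvent ξ n)) := by
      rw [hcycle, ENNReal.ofReal_mul (q := 4 * D) (by positivity),
        ENNReal.ofReal_mul (p := 4) (by norm_num), ENNReal.ofReal_ofNat]
      ring
    _ ≤ ENNReal.ofReal (b n) * (n * P (sizeEvent ξ n)) := by gcongr
    _ = _ := by ring
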